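/- **Model.** Let $D=(X,U,Z,Y)$ with observed covariates $X\in\mathbb R^p$, an unmeasured confounder $U\in\mathbb R$, a treatment $Z\in\mathbb R$ and an outcome $Y\in\mathbb R$; only $O=(X,Z,Y)$ is observed. For $\theta=(\lambda,\beta,\kappa)\in\mathbb R^q$, $q=2p+1$, and known sensitivity parameters $\delta,\gamma$, the law of $D$ in the semiparametric model $\mathcal M_U$ is $$f(y\mid x,z,u;\theta)\,\nu_1(dy)\;f(z\mid x,u;\theta)\,\nu_2(dz)\;F(du\mid x)\;\mu_X(dx),$$ where $\mu_X$ (the law of $X$) and $F(\cdot\mid x)$ are arbitrary, and $f(y\mid x,z,u;\theta)$, $f(z\mid x,u;\theta)$ are densities of exponential families with canonical links and known dispersions, $\exp\{(t\eta-b(\eta))/\phi\}$, with natural parameters $\eta=\lambda^Tx+\beta z+\delta u$ and $\eta=\kappa^Tx+\gamma u$ respectively. Let $f_\theta(z,y\mid x,u)$ be the product of the two densities and $S_\theta(D)=\nabla_\theta\log f_\theta(Z,Y\mid X,U)$ the full data score. Let $\theta_0,F,\mu_X$ be the truth, $\mathbb E$ the expectation under it, and let $O_1,O_2,\dots$ be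 i.i.d. copies of $O$. **Working score.** Let $F^*(du\mid x)$ be a (possibly incorrect) working conditional law of $U$ given $X$ with $F(\cdot\mid x)\ll F^*(\cdot\mid x)$ for $\mu_X$-a.e. $x$, and let $\mathbb E_{*,\theta}$ be the expectation under the law with parameter $\theta$ in which $F$ is replaced by $F^*$. For $\theta$ in an open neighbourhood $N$ of $\theta_0$, let $a_\theta(U,X)$ be a square integrable solution of $$\mathbb E_{*,\theta}[a_\theta\mid X]=0,\qquad \mathbb E_{*,\theta}\big[S^*_\theta(O)\mid X,U\big]=\mathbb E_{*,\theta}\big\{\mathbb E_{*,\theta}[a_\theta\mid O]\mid X,U\big\},\qquad S^*_\theta(O)=\mathbb E_{*,\theta}[S_\theta(D)\mid O],$$ and put $S^*_{\rm eff}(O;\theta)=S^*_\theta(O)-\mathbb E_{*,\theta}[a_\theta(U,X)\mid O]$ (conditional expectations given $O$ are taken in the version given by Bayes' formula). **Regularity conditions.** (R0) Almost everywhere, the natural parameters lie in the interior of the natural parameter sets for all $\theta\in N$; $S_\theta$ is square integrable under the working law at $\theta$, for each $\theta\in N$; $\mathbb E\|S^*_{\rm eff}(O;\theta_0)\|^2<\infty$.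 (R1) For almost every $o$, $\theta\mapsto S^*_{\rm eff}(o;\theta)$ is $C^1$ on $N$. (R2) For each $\theta\in N$, $\partial S^*_{\rm eff}(O;\theta)/\partial\theta^T$ is integrable, and $n^{-1}\sum_{i\le n}\partial S^*_{\rm eff}(O_i;\theta)/\partial\theta^T$ converges in probability to its expectation, uniformly on $N$. (R3) $A=\mathbb E\{\partial S^*_{\rm eff}(O;\theta_0)/\partial\theta^T\}$ is invertible. **Theorem, part 1.** Under these conditions there is an open neighbourhood $N_0$ of $\theta_0$ such that 1. with probability tending to one, the equation $\sum_{i=1}^nS^*_{\rm eff}(O_i;\theta)=0$ has exactly one root in $N_0$, and there are measurable functions $\hat\theta_n=\hat\theta_n(O_1,\dots,O_n)$ that are a root in $N_0$ with probability tending to one; 2. every sequence of random vectors $\hat\theta_n$ that is, with probability tending to one, a root in $N_0$ satisfies $\hat\theta_n\to\theta_0$ in probability and $\sqrt n(\hat\theta_n-\theta_0)\to N(0,\Sigma)$ in distribution, where $$\Sigma=A^{-1}\,\mathbb E\{S^*_{\rm eff}(O;\theta_0)S^*_{\rm eff}(O;\theta_0)^T\}\,(A^T)^{-1}$$ (that is,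 $\hat\theta_n$ has approximate covariance matrix $\Sigma/n$). **Theorem, part 2 (local efficiency).** Suppose in addition that the working model is correct, $F^*(\cdot\mid x)=F(\cdot\mid x)$ for $\mu_X$-a.e. $x$, and that $\sup_{\theta\in N}\big\|\partial\{f_\theta(z,y\mid x,u)S^*_{\rm eff}(x,z,y;\theta)\}/\partial\theta^T\big\|$ is almost everywhere bounded by a function that is integrable with respect to $\mu_X(dx)F(du\mid x)\nu_2(dz)\nu_1(dy)$. Let $\Lambda$ be the observed data nuisance tangent space at the truth, i.e. the closure in $L^2$ of $$\{a_1(X):\mathbb E[a_1(X)]=0\}+\{\mathbb E[a_2(U,X)\mid O]:\mathbb E[a_2(U,X)\mid X]=0\}$$ ($a_1,a_2$ square integrable, $\mathbb R^q$-valued), let $S_{\rm eff}=S_{\theta_0}(O)-\Pi[S_{\theta_0}(O)\mid\Lambda]$, with $S_{\theta_0}(O)=\mathbb E[S_{\theta_0}(D)\mid O]$, be the efficient score, $\varphi_{\rm eff}=\mathbb E[S_{\rm eff}S_{\rm eff}^T]^{-1}S_{\rm eff}$ the efficient influence function and $V_{\rm eff}=\mathbb E[\varphi_{\rm eff}\varphi_{\rm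 eff}^T]$ the semiparametric efficiency bound. Then $S^*_{\rm eff}(O;\theta_0)=S_{\rm eff}$ almost surely, $\mathbb E[S_{\rm eff}S_{\rm eff}^T]$ is invertible, and $\hat\theta_n$ attains the bound: $$\Sigma=V_{\rm eff}=\mathbb E[S_{\rm eff}S_{\rm eff}^T]^{-1}.$$ Moreover $\varphi_{\rm eff}$ is an influence function, and $\mathbb E[\varphi\varphi^T]-V_{\rm eff}$ is positive semidefinite for every influence function $\varphi$, where an influence function is a square integrable, mean zero $\varphi(O)\in\mathbb R^q$ with $\varphi\perp\Lambda$ and $\mathbb E[S_{\theta_0}(D)\varphi(O)^T]=I$. -/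

import Mathlib

open MeasureTheory ProbabilityTheory Filter Topology

noncomputable section

namespace SensitivityAnalysis

/-- Index set of the parameter `θ = (λ, β, κ)`: `λ` and `κ` have one coordinate per covariate. -/
abbrev ParamIdx (p : ℕ) : Type := Fin p ⊕ Unit ⊕ Fin p

/-- The parameter space `ℝ^q`, `q = 2 p + 1`, with its Euclidean norm. -/
abbrev Param (p : ℕ) : Type := EuclideanSpace ℝ (ParamIdx p)

/-- The vector of observed covariates. -/
abbrev Cov (p : ℕ) : Type := Fin p → ℝ

/-- Observed data `(x, (z, y))`. -/
abbrev Obs (p : ℕ) : Type := Cov p × (ℝ × ℝ)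

/-- Full data `((x, u), (z, y))`. -/
abbrev FullData (p : ℕ) : Type := (Cov p × ℝ) × (ℝ × ℝ)

/-- The observed part of the full data: `u` is dropped. -/
def obs {p : ℕ} (d : FullData p) : Obs p := (d.1.1, d.2)

/-! ### Exponential families and the semiparametric model -/

/-- A one-parameter exponential (dispersion) family on `ℝ`, with known dispersion `φ` and densities
`exp ((y η - b(η)) / φ)` with respect to a σ-finite base measure. -/
structure ExpFamily where
  base : Measure ℝ
  sigmaFinite_base : SigmaFinite base
  base_ne_zero : base ≠ 0
  disp : ℝ
  disp_pos : 0 < disp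

attribute [instance] ExpFamily.sigmaFinite_base

namespace ExpFamily

/-- The natural parameter set: the `η` for which `∫ exp (y η / φ)` is finite. -/
def natDomain (E : ExpFamily) : Set ℝ := {η | η / E.disp ∈ integrableExpSet id E.base}

/-- The cumulant function `b(η) = φ log ∫ exp (y η / φ)`. The mean of the member of the family with
natural parameter `η` is `b'(η)`, so the canonical link is the inverse of `b'`. -/
def cumulant (E : ExpFamily) (η : ℝ) : ℝ := E.disp * cgf id E.base (η / E.disp)

/-- The density of the member of the family with natural parameter `η`. -/
def density (E : ExpFamily) (η y : ℝ) : ℝ := Real.exp ((y * η - E.cumulant η) / E.disp)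

end ExpFamily

/-- The parametric part of the model: the exponential families of the outcome and of the treatment,
and the two sensitivity parameters `δ`, `γ`. -/
structure Model where
  outcome : ExpFamily
  treatment : ExpFamily
  δ : ℝ
  γ : ℝ

namespace Model

variable {p : ℕ}

/-- Linear predictor `λᵀ x + β z + δ u` of the outcome. With a canonical link it is the natural
parameter of the law of the outcome given `(x, u, z)`. -/
def outcomePred (M : Model) (θ : Param p) (d : FullData p) : ℝ :=
  (∑ i, θ (Sum.inl i) * d.1.1 i) + θ (Sum.inr (Sum.inl ())) * d.2.1 + M.δ * d.1.2

/-- Linear predictor `κᵀ x + γ u` of the treatment, the natural parameter of its law given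
`(x, u)`. -/
def treatmentPred (M : Model) (θ : Param p) (d : FullData p) : ℝ :=
  (∑ i, θ (Sum.inr (Sum.inr i)) * d.1.1 i) + M.γ * d.1.2

/-- `f(z | x, u; θ) f(y | x, z, u; θ)`, a density of `(Z, Y)` given `(X, U) = (x, u)` with respect
to the product of the two base measures. -/
def density (M : Model) (θ : Param p) (d : FullData p) : ℝ :=
  M.treatment.density (M.treatmentPred θ d) d.2.1 * M.outcome.density (M.outcomePred θ d) d.2.2

/-- Product of the base measures, on the space of `(z, y)`. -/
def baseZY (M : Model) : Measure (ℝ × ℝ) := M.treatment.base.prod M.outcome.base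

/-- The measure `f(dx) G(du | x) ν₂(dz) ν₁(dy)` on the full data space, where `μX` is the law of `X`
and `G` a conditional law of `U` given `X`. -/
def dominating (M : Model) (μX : Measure (Cov p)) (G : Kernel (Cov p) ℝ) :
    Measure (FullData p) := (μX ⊗ₘ G).prod M.baseZY

/-- The law `f(y | z, x, u; θ) f(z | x, u; θ) G(du | x) f(dx)` of the full data. -/
def fullLaw (M : Model) (μX : Measure (Cov p)) (G : Kernel (Cov p) ℝ) (θ : Param p) :
    Measure (FullData p) :=
  (M.dominating μX G).withDensity (fun d => ENNReal.ofReal (M.density θ d))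

/-- The law of the observed data `(X, Z, Y)`. -/
def obsLaw (M : Model) (μX : Measure (Cov p)) (G : Kernel (Cov p) ℝ) (θ : Param p) :
    Measure (Obs p) := (M.fullLaw μX G θ).map obs

/-- The full data score `S_θ(x, u, z, y)`: the gradient in `θ` of the log-likelihood. -/
def fullScore (M : Model) (θ : Param p) (d : FullData p) : Param p :=
  gradient (fun ϑ : Param p => Real.log (M.density ϑ d)) θ

/-- `E[h(X, U, Z, Y) | X, Z, Y]` under the law with conditional law `G` of `U` given `X` and with
parameter `θ`, as a function of the observed data, by Bayes' formula. -/
def condExpObs (M : Model) (G : Kernel (Cov p) ℝ) (θ : Param p) (h : FullData p → Param p)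
    (o : Obs p) : Param p :=
  (∫ u, M.density θ ((o.1, u), o.2) ∂(G o.1))⁻¹ •
    ∫ u, M.density θ ((o.1, u), o.2) • h ((o.1, u), o.2) ∂(G o.1)

/-- `E[h(X, Z, Y) | X = x, U = u]` under the parameter `θ`. -/
def condExpXU (M : Model) (θ : Param p) (h : Obs p → Param p) (xu : Cov p × ℝ) : Param p :=
  ∫ zy, M.density θ (xu, zy) • h (xu.1, zy) ∂M.baseZY

/-- `a = a(x, u)` is, at the parameter `θ` and for the working model `Fstar`, a square integrable
solution of `E⁎[a(U, X) | X] = 0` and of the integral equation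
`E⁎[S⁎_θ(X, Z, Y) | X, U] = E⁎{E⁎[a(U, X) | X, Z, Y] | X, U}`. -/
structure SolvesIntegralEquation (M : Model) (μX : Measure (Cov p)) (Fstar : Kernel (Cov p) ℝ)
    (θ : Param p) (a : Cov p × ℝ → Param p) : Prop where
  measurable : Measurable a
  memLp : MemLp (fun d : FullData p => a d.1) 2 (M.fullLaw μX Fstar θ)
  mean_zero : ∀ᵐ x ∂μX, ∫ u, a (x, u) ∂(Fstar x) = 0
  equation : ∀ᵐ xu ∂(μX ⊗ₘ Fstar),
    M.condExpXU θ (M.condExpObs Fstar θ (M.fullScore θ)) xu =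
      M.condExpXU θ (M.condExpObs Fstar θ (fun d => a d.1)) xu

/-- The working efficient score
`S⁎_eff(x, z, y; θ) = S⁎_θ(x, z, y) - E⁎[a_θ(U, X) | X = x, Z = z, Y = y]`. -/
def workingScore (M : Model) (Fstar : Kernel (Cov p) ℝ) (a : Param p → Cov p × ℝ → Param p)
    (θ : Param p) (o : Obs p) : Param p :=
  M.condExpObs Fstar θ (M.fullScore θ) o - M.condExpObs Fstar θ (fun d => a θ d.1) o

end Model

/-! ### Moments and the sandwich covariance -/

section Moments

variable {p : ℕ} {T : Type*} [MeasurableSpace T]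

/-- `E[s sᵀ]`. -/
def secondMoment (P : Measure T) (s : T → Param p) : Matrix (ParamIdx p) (ParamIdx p) ℝ :=
  Matrix.of fun i j => ∫ t, s t i * s t j ∂P

/-- The matrix `E[∂ s(·; θ₀) / ∂θᵀ]`, whose `(i, j)` entry is `E[∂ sᵢ / ∂θⱼ]`. -/
def meanJacobian (P : Measure T) (s : Param p → T → Param p) (θ₀ : Param p) :
    Matrix (ParamIdx p) (ParamIdx p) ℝ :=
  Matrix.of fun i j =>
    ∫ t, (fderiv ℝ (fun θ => s θ t) θ₀ (EuclideanSpace.single j (1 : ℝ))) i ∂P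

/-- The sandwich matrix `A⁻¹ B (Aᵀ)⁻¹`, `A = E[∂ s / ∂θᵀ]`, `B = E[s sᵀ]`, at `θ₀`. -/
def sandwich (P : Measure T) (s : Param p → T → Param p) (θ₀ : Param p) :
    Matrix (ParamIdx p) (ParamIdx p) ℝ :=
  (meanJacobian P s θ₀)⁻¹ * secondMoment P (s θ₀) * ((meanJacobian P s θ₀).transpose)⁻¹

end Moments

/-! ### Tangent spaces, the efficient score and the efficiency bound at a law of the full data -/

section Efficiency

variable {p : ℕ}

/-- The σ-algebra generated by `X` on the full data space. -/
abbrev sigmaX (p : ℕ) : MeasurableSpace (FullData p) :=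
  MeasurableSpace.comap (fun d : FullData p => d.1.1) inferInstance

/-- The σ-algebra generated by the observed data `(X, Z, Y)` on the full data space. -/
abbrev sigmaObs (p : ℕ) : MeasurableSpace (FullData p) :=
  MeasurableSpace.comap (obs : FullData p → Obs p) inferInstance

/-- `{a₁(X) : E[a₁(X)] = 0} ∩ L²`. -/
def fullNuisance₁ (P : Measure (FullData p)) : Set (FullData p → Param p) :=
  {h | (∃ a : Cov p → Param p, Measurable a ∧ h = fun d => a d.1.1) ∧ MemLp h 2 P ∧ ∫ d, h d ∂P = 0}

/-- `{a₂(U, X) : E[a₂(U, X) | X] = 0} ∩ L²`. -/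
def fullNuisance₂ (P : Measure (FullData p)) : Set (FullData p → Param p) :=
  {h | (∃ a : Cov p × ℝ → Param p, Measurable a ∧ h = fun d => a d.1) ∧ MemLp h 2 P ∧
    P[h | sigmaX p] =ᵐ[P] 0}

/-- The observed data nuisance tangent space: the mean square closure of the sum of the images of
the two full data nuisance tangent spaces under `E[· | X, Z, Y]`. -/
def nuisanceTangentSpace (P : Measure (FullData p)) : Submodule ℝ (Lp (Param p) 2 P) :=
  (Submodule.span ℝ {g : Lp (Param p) 2 P | ∃ h ∈ fullNuisance₁ P, g =ᵐ[P] P[h | sigmaObs p]} ⊔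
    Submodule.span ℝ {g : Lp (Param p) 2 P | ∃ h ∈ fullNuisance₂ P, g =ᵐ[P] P[h | sigmaObs p]}
    ).topologicalClosure

instance (P : Measure (FullData p)) : (nuisanceTangentSpace P).HasOrthogonalProjection :=
  haveI : CompleteSpace (nuisanceTangentSpace P) :=
    (Submodule.isClosed_topologicalClosure _).completeSpace_coe
  inferInstance

open Classical in
/-- The class in `L²(P)` of a square integrable function (zero for other functions). -/
def toL2 (P : Measure (FullData p)) (f : FullData p → Param p) : Lp (Param p) 2 P :=
  if h : MemLp f 2 P then h.toLp f else 0

/-- The observed data efficient score `S_eff = S_θ(X, Z, Y) - Π[S_θ(X, Z, Y) | Λ]`, where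
`S_θ(X, Z, Y) = E[S_θ(X, U, Z, Y) | X, Z, Y]` and `S` is the full data score. -/
def efficientScore (P : Measure (FullData p)) (S : FullData p → Param p) : Lp (Param p) 2 P :=
  toL2 P (P[S | sigmaObs p]) -
    (nuisanceTangentSpace P).starProjection (toL2 P (P[S | sigmaObs p]))

/-- The efficient information matrix `E[S_eff S_effᵀ]`. -/
def efficientInformation (P : Measure (FullData p)) (S : FullData p → Param p) :
    Matrix (ParamIdx p) (ParamIdx p) ℝ :=
  secondMoment P (efficientScore P S)

/-- The efficient influence function: the normalization `E[S_eff S_effᵀ]⁻¹ S_eff` of the efficient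
score. -/
def efficientInfluence (P : Measure (FullData p)) (S : FullData p → Param p) (d : FullData p) :
    Param p :=
  WithLp.toLp 2 ((efficientInformation P S)⁻¹.mulVec (WithLp.ofLp (efficientScore P S d)))

/-- The semiparametric efficiency bound: the variance of the efficient influence function. -/
def efficiencyBound (P : Measure (FullData p)) (S : FullData p → Param p) :
    Matrix (ParamIdx p) (ParamIdx p) ℝ :=
  secondMoment P (efficientInfluence P S)

/-- Observed data influence functions for `θ`: mean zero, square integrable functions `φ(X, Z, Y)`
that are orthogonal to the nuisance tangent space and satisfy `E[S φᵀ] = I`. -/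
structure IsInfluenceFunction (P : Measure (FullData p)) (S : FullData p → Param p)
    (φ : Obs p → Param p) : Prop where
  measurable : Measurable φ
  memLp : MemLp (fun d => φ (obs d)) 2 P
  mean_zero : ∫ d, φ (obs d) ∂P = 0
  orthogonal : ∀ g ∈ nuisanceTangentSpace P, ∫ d, inner ℝ (φ (obs d)) (g d) ∂P = 0
  normalized : ∀ i j, ∫ d, S d i * φ (obs d) j ∂P = (1 : Matrix (ParamIdx p) (ParamIdx p) ℝ) i j

end Efficiency

end SensitivityAnalysis

end

set_option linter.unusedSectionVars false

/-! The integral equation for `a_θ` says exactly that the working score has conditional mean zero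
given (X, U). That conditional mean involves only the parametric density of (Z, Y) given (X, U), not
the law of U. It therefore still vanishes under the true F as soon as F ≪ F*, and the working score
has mean zero at θ₀ even if F* is wrong (`condExpXU_workingScore`, `integral_eq_zero_of_condExpXU`).

For an unbiased estimating function the asymptotics are those of a Z-estimator
(`estimatingEquation_asymptotics`). Uniform convergence of the empirical Jacobians makes the
averaged score, on a small ball around θ₀, a perturbation of the invertible linear map A whose
Lipschitz constant is small compared with 1/‖A⁻¹‖. Such a map is injective with Lipschitz inverse,
and it attains zero once its value at θ₀ is small, which holds with probability tending to one. The
root is thus unique and its distance to θ₀ is of order n^{-1/2}. Rerunning the linear approximation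
with an arbitrarily small error gives √n(θ̂ - θ₀) = -A⁻¹ n^{-1/2} ∑ S*_eff(O_i; θ₀) + o_P(1), and
the central limit theorem yields the sandwich covariance.

If F* = F, then E[S | O] = E[a | O] + S*_eff. The first term lies in Λ; the second is orthogonal to
Λ, because E[φ(O) E[b(U,X) | O]ᵀ] = E[φ(O) b(U,X)ᵀ] = 0 whenever E[φ | X, U] = 0. Hence S*_eff is
the efficient score (`workingScore_ae_eq_efficientScore`). Differentiating E_θ[S*_eff(O; θ)] = 0
under the integral gives A = -E[S*_eff Sᵀ] (`meanJacobian_workingScore`), which by orthogonality is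
-B with B = E[S_eff S_effᵀ]. So B is invertible and the sandwich collapses to B⁻¹. Every influence
function φ has E[φ S_effᵀ] = I, whence E[φφᵀ] - B⁻¹ is the second moment of φ - B⁻¹ S_eff
(`workingScore_efficient`). -/

noncomputable section

namespace SensitivityAnalysis

/-! ### Events whose probability tends to one -/

section HighProbability

variable {Ω : Type*} [MeasurableSpace Ω] {Pr : Measure Ω}

/-- The events `p n` hold with (inner) probability tending to one. -/
def WithHighProb (Pr : Measure Ω) (p : ℕ → Ω → Prop) : Prop :=
  Tendsto (fun n => Pr {ω | ¬ p n ω}) atTop (𝓝 0)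

lemma WithHighProb.mono_ae {p q : ℕ → Ω → Prop} (hp : WithHighProb Pr p)
    (h : ∀ n, ∀ᵐ ω ∂Pr, p n ω → q n ω) : WithHighProb Pr q := by
  refine tendsto_of_tendsto_of_tendsto_of_le_of_le tendsto_const_nhds hp (fun _ => zero_le) ?_
  intro n
  refine measure_mono_ae ?_
  filter_upwards [h n] with ω hω using fun hq hp => hq (hω hp)

lemma WithHighProb.mono {p q : ℕ → Ω → Prop} (hp : WithHighProb Pr p)
    (h : ∀ n ω, p n ω → q n ω) : WithHighProb Pr q :=
  hp.mono_ae fun n => ae_of_all _ (h n)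

/-- The union bound holds for outer measure, so the events, which may involve uncountable
quantifiers over the parameter, need not be measurable. -/
lemma WithHighProb.and {p q : ℕ → Ω → Prop} (hp : WithHighProb Pr p) (hq : WithHighProb Pr q) :
    WithHighProb Pr (fun n ω => p n ω ∧ q n ω) := by
  have := Tendsto.add hp hq
  rw [add_zero] at this
  refine tendsto_of_tendsto_of_tendsto_of_le_of_le tendsto_const_nhds this (fun _ => zero_le) ?_
  intro n
  refine le_trans (measure_mono ?_) (measure_union_le _ _)
  intro ω hω
  simp only [Set.mem_ofPred_eq, not_and_or] at hω
  exact hω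

lemma WithHighProb.of_ae {p : ℕ → Ω → Prop} (h : ∀ n, ∀ᵐ ω ∂Pr, p n ω) : WithHighProb Pr p := by
  have : (fun n => Pr {ω | ¬ p n ω}) = fun _ => 0 := funext fun n => h n
  simp [WithHighProb, this]

/-- Serves to draw deterministic conclusions, such as continuity of a limit, from a single good
outcome. -/
lemma WithHighProb.exists [IsProbabilityMeasure Pr] {p : ℕ → Ω → Prop}
    (hp : WithHighProb Pr p) : ∃ n ω, p n ω := by
  obtain ⟨n, hn⟩ := (hp.eventually_lt_const (zero_lt_one (α := ENNReal))).exists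
  by_contra! h
  have : {ω | ¬ p n ω} = Set.univ := by ext ω; simpa using h n ω
  rw [this, measure_univ] at hn
  exact lt_irrefl _ hn

end HighProbability

/-! ### Roots of small Lipschitz perturbations of an invertible linear map -/

section Deterministic

variable {E : Type*} [NormedAddCommGroup E] [NormedSpace ℝ E]
  {G : E → E} {A B : E →L[ℝ] E} {K r : ℝ} {θ₀ : E} {s : Set E}

/-- Applying the inverse `B`, of norm at most `K`, to the linearisation error costs at most half of
`‖x - y‖`, which is absorbed on the left. -/
lemma norm_sub_le_of_approximates (hK : 0 < K) (hB : ∀ x, ‖B x‖ ≤ K * ‖x‖)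
    (hBA : ∀ x, B (A x) = x)
    (hG : ∀ x ∈ s, ∀ y ∈ s, ‖G x - G y - A (x - y)‖ ≤ 1 / (2 * K) * ‖x - y‖)
    {x y : E} (hx : x ∈ s) (hy : y ∈ s) : ‖x - y‖ ≤ 2 * K * ‖G x - G y‖ := by
  have h1 : x - y = B (G x - G y) - B (G x - G y - A (x - y)) := by
    rw [← map_sub, sub_sub_cancel, hBA]
  have h2 : ‖x - y‖ ≤ K * ‖G x - G y‖ + K * (1 / (2 * K) * ‖x - y‖) := by
    calc ‖x - y‖ = ‖B (G x - G y) - B (G x - G y - A (x - y))‖ := by rw [← h1]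
      _ ≤ ‖B (G x - G y)‖ + ‖B (G x - G y - A (x - y))‖ := norm_sub_le _ _
      _ ≤ _ := add_le_add (hB _) ((hB _).trans (by gcongr; exact hG x hx y hy))
  have h3 : K * (1 / (2 * K) * ‖x - y‖) = ‖x - y‖ / 2 := by field_simp
  rw [h3] at h2
  linarith

lemma exists_root_of_approximates [CompleteSpace E] (hK : 0 < K) (hr : 0 < r)
    (hB : ∀ x, ‖B x‖ ≤ K * ‖x‖) (hAB : ∀ x, A (B x) = x)
    (hG : ∀ x ∈ Metric.ball θ₀ r, ∀ y ∈ Metric.ball θ₀ r,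
      ‖G x - G y - A (x - y)‖ ≤ 1 / (2 * K) * ‖x - y‖)
    (h0 : ‖G θ₀‖ ≤ r / (4 * K)) : ∃ θ ∈ Metric.ball θ₀ r, G θ = 0 := by
  have hc : (0 : ℝ) ≤ 1 / (2 * K) := by positivity
  have happ : ApproximatesLinearOn G A (Metric.ball θ₀ r) ⟨1 / (2 * K), hc⟩ := hG
  let R : A.NonlinearRightInverse := ⟨B, ⟨K, hK.le⟩, hB, hAB⟩
  have hsub : Metric.closedBall θ₀ (r / 2) ⊆ Metric.ball θ₀ r :=
    Metric.closedBall_subset_ball (by linarith)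
  have := happ.surjOn_closedBall_of_nonlinearRightInverse R (by positivity) hsub
  -- The image of the ball of radius `r / 2` contains a ball of radius `(1/K - 1/(2K)) * (r/2) =
  -- r/(4K)` around `G θ₀`. Halving `r` keeps the closed ball inside the open one.
  have hmem : (0 : E) ∈ Metric.closedBall (G θ₀)
      (((R.nnnorm : ℝ)⁻¹ - ((⟨1 / (2 * K), hc⟩ : NNReal) : ℝ)) * (r / 2)) := by
    have h2 : (K⁻¹ - 1 / (2 * K)) * (r / 2) = r / (4 * K) := by field_simp; ring
    rw [Metric.mem_closedBall, dist_zero_left]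
    change _ ≤ (K⁻¹ - 1 / (2 * K)) * (r / 2)
    rwa [h2]
  obtain ⟨θ, hθ, h⟩ := this hmem
  exact ⟨θ, hsub hθ, h⟩

end Deterministic

/-! ### Measurable selection of roots -/

section Selection

variable {E : Type*} [NormedAddCommGroup E] [CompleteSpace E] [SecondCountableTopology E]
  [MeasurableSpace E] [BorelSpace E] {α : Type*} [MeasurableSpace α]

lemma exists_measurable_limit {f : ℕ → α → E} (hf : ∀ k, Measurable (f k)) :
    ∃ g : α → E, Measurable g ∧ ∀ a c, Tendsto (fun k => f k a) atTop (𝓝 c) → g a = c := by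
  classical
  let S : Set α := {a | ∃ c, Tendsto (fun k => f k a) atTop (𝓝 c)}
  have hS : MeasurableSet S := measurableSet_exists_tendsto hf
  let g : α → E := fun a => if h : a ∈ S then h.choose else 0
  refine ⟨g, ?_, ?_⟩
  · refine measurable_of_tendsto_metrizable (f := fun k => S.indicator (f k))
      (fun k => (hf k).indicator hS) ?_
    rw [tendsto_pi_nhds]
    intro a
    by_cases h : a ∈ S
    · simpa [g, h] using h.choose_spec
    · simp [g, h]
  · intro a c hc
    have h : a ∈ S := ⟨c, hc⟩
    simp only [g, dif_pos h]
    exact tendsto_nhds_unique h.choose_spec hc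

/-- Measurable selection of an approximate zero along a sequence `d` of points, when the values
`g j` at the points `d j` control the distance to the zero. -/
lemma exists_measurable_selection (d : ℕ → E) {g : ℕ → α → E} (hg : ∀ j, Measurable (g j)) :
    ∃ est : α → E, Measurable est ∧ ∀ a θ C, (∀ j, ‖d j - θ‖ ≤ C * ‖g j a‖) →
      (∀ ε : ℝ, 0 < ε → ∃ j, ‖g j a‖ < ε) → est a = θ := by
  classical
  -- The second alternative makes some index admissible for every `a`, so that the first admissible
  -- index is everywhere defined and measurable in `a`. At the points of interest only the first
  -- alternative occurs.
  let q : ℕ → α → ℕ → Prop := fun k a j =>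
    ‖g j a‖ < 1 / ((k : ℝ) + 1) ∨ ¬ ∃ i, ‖g i a‖ < 1 / ((k : ℝ) + 1)
  have hq : ∀ k a, ∃ j, q k a j := by
    intro k a
    by_cases h : ∃ i, ‖g i a‖ < 1 / ((k : ℝ) + 1)
    · exact ⟨h.choose, Or.inl h.choose_spec⟩
    · exact ⟨0, Or.inr h⟩
  have hm1 : ∀ k j, MeasurableSet {a | ‖g j a‖ < 1 / ((k : ℝ) + 1)} := fun k j =>
    measurableSet_lt (hg j).norm measurable_const
  have hm : ∀ k j, MeasurableSet {a | q k a j} := by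
    intro k j
    refine (hm1 k j).union ?_
    refine MeasurableSet.compl ?_
    have : {a | ∃ i, ‖g i a‖ < 1 / ((k : ℝ) + 1)} = ⋃ i, {a | ‖g i a‖ < 1 / ((k : ℝ) + 1)} := by
      ext a; simp
    change MeasurableSet {a | ∃ i, ‖g i a‖ < 1 / ((k : ℝ) + 1)}
    rw [this]
    exact MeasurableSet.iUnion (hm1 k)
  have hT : ∀ k, Measurable (fun a => d (Nat.find (hq k a))) := fun k =>
    (measurable_from_nat (f := d)).comp (measurable_find (hq k) (hm k))
  obtain ⟨est, hest, hlim⟩ := exists_measurable_limit hT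
  refine ⟨est, hest, fun a θ C h1 h2 => hlim a θ ?_⟩
  rw [tendsto_iff_norm_sub_tendsto_zero]
  -- The sign of `C` is not prescribed, hence the absolute value.
  have hlim : Tendsto (fun k : ℕ => |C| * (1 / ((k : ℝ) + 1))) atTop (𝓝 0) := by
    simpa using (tendsto_one_div_add_atTop_nhds_zero_nat (𝕜 := ℝ)).const_mul |C|
  refine squeeze_zero (fun _ => norm_nonneg _) (fun k => ?_) hlim
  have hspec := Nat.find_spec (hq k a)
  have hlt : ‖g (Nat.find (hq k a)) a‖ < 1 / ((k : ℝ) + 1) := by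
    rcases hspec with h | h
    · exact h
    · exact absurd (h2 _ (by positivity)) h
  calc _ ≤ C * ‖g (Nat.find (hq k a)) a‖ := h1 _
    _ ≤ |C| * ‖g (Nat.find (hq k a)) a‖ := by gcongr; exact le_abs_self C
    _ ≤ _ := by gcongr

end Selection

/-! ### Multivariate central limit theorem and tightness -/

section CentralLimit

variable {ι : Type*} [Fintype ι] {Ω : Type*} [MeasurableSpace Ω] {Pr : Measure Ω}

lemma integrable_coord_mul_coord {S : Type*} [MeasurableSpace S] {P : Measure S}
    {f g : S → EuclideanSpace ℝ ι} (hf : MemLp f 2 P) (hg : MemLp g 2 P) (i j : ι) :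
    Integrable (fun t => f t i * g t j) P :=
  ((EuclideanSpace.proj (𝕜 := ℝ) i).comp_memLp' hf).integrable_mul
    ((EuclideanSpace.proj (𝕜 := ℝ) j).comp_memLp' hg)

/-- The quadratic form of the second moment matrix is the second moment of a projection. This gives
both positive semidefiniteness and the variance in the Cramér–Wold reduction. -/
lemma dotProduct_mulVec_integral_coord {S : Type*} [MeasurableSpace S] {P : Measure S}
    {f : S → EuclideanSpace ℝ ι} (hf : MemLp f 2 P) (x : EuclideanSpace ℝ ι) :
    x.ofLp ⬝ᵥ (Matrix.of fun i j => ∫ t, f t i * f t j ∂P).mulVec x.ofLp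
      = ∫ t, (inner ℝ (f t) x) ^ 2 ∂P := by
  have h : ∀ t, (inner ℝ (f t) x) ^ 2 = ∑ i, ∑ j, x i * (f t i * f t j) * x j := by
    intro t
    rw [PiLp.inner_apply, sq, Finset.sum_mul_sum]
    refine Finset.sum_congr rfl fun i _ => Finset.sum_congr rfl fun j _ => ?_
    simp only [RCLike.inner_apply, conj_trivial]
    ring
  have hint : ∀ i j, Integrable (fun t => x i * (f t i * f t j) * x j) P := fun i j =>
    ((integrable_coord_mul_coord hf hf i j).const_mul _).mul_const _
  simp_rw [h]
  rw [integral_finsetSum _ fun i _ => integrable_finsetSum _ fun j _ => hint i j]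
  simp_rw [integral_finsetSum _ fun j _ => hint _ j, integral_mul_const, integral_const_mul]
  simp only [dotProduct, Matrix.mulVec, Matrix.of_apply, Finset.mul_sum, mul_assoc]

lemma posSemidef_integral_coord {S : Type*} [MeasurableSpace S] {P : Measure S}
    {f : S → EuclideanSpace ℝ ι} (hf : MemLp f 2 P) :
    (Matrix.of fun i j => ∫ t, f t i * f t j ∂P).PosSemidef := by
  refine Matrix.PosSemidef.of_dotProduct_mulVec_nonneg ?_ fun x => ?_
  · ext i j
    simp [Matrix.conjTranspose_apply, mul_comm]
  · have := dotProduct_mulVec_integral_coord hf (WithLp.toLp 2 x)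
    simp only [star_trivial]
    rw [this]
    exact integral_nonneg fun t => sq_nonneg _

variable [DecidableEq ι]

/-- Multivariate central limit theorem, at the level of characteristic functions. -/
lemma tendsto_charFun_inv_sqrt_smul_sum [IsProbabilityMeasure Pr]
    {ξ : ℕ → Ω → EuclideanSpace ℝ ι} (hindep : iIndepFun ξ Pr)
    (hident : ∀ i, IdentDistrib (ξ i) (ξ 0) Pr Pr) (hL2 : MemLp (ξ 0) 2 Pr)
    (hmean : ∫ ω, ξ 0 ω ∂Pr = 0) (t : EuclideanSpace ℝ ι) :
    Tendsto (fun n : ℕ => charFun (Pr.map fun ω => (√(n : ℝ))⁻¹ • ∑ i ∈ Finset.range n, ξ i ω) t)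
      atTop (𝓝 (charFun (multivariateGaussian 0
        (Matrix.of fun i j => ∫ ω, ξ 0 ω i * ξ 0 ω j ∂Pr)) t)) := by
  have hmeas : Measurable (fun x : EuclideanSpace ℝ ι => inner ℝ x t) := by fun_prop
  let X : ℕ → Ω → ℝ := fun i ω => inner ℝ (ξ i ω) t
  have hX : iIndepFun X Pr := hindep.comp (fun _ x => inner ℝ x t) fun _ => hmeas
  have hid : ∀ i, IdentDistrib (X i) (X 0) Pr Pr := fun i => (hident i).comp hmeas
  have hX2 : MemLp (X 0) 2 Pr := hL2.inner_const t
  have hX0 : ∫ ω, X 0 ω ∂Pr = 0 := by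
    have := integral_inner (𝕜 := ℝ) (hL2.integrable one_le_two) t
    rw [hmean, inner_zero_right] at this
    rw [← this]
    exact integral_congr_ae (ae_of_all _ fun ω => real_inner_comm _ _)
  -- Cramér–Wold: the characteristic function of the vector sum at `t` is that of its projection on
  -- `t` at `1`, so the scalar theorem suffices.
  have hclt := tendstoInDistribution_inv_sqrt_mul_sum_sub (Y := id)
    (P' := gaussianReal 0 Var[X 0; Pr].toNNReal) (HasLaw.id) hX2 hX hid
  have h1 := ProbabilityMeasure.tendsto_iff_tendsto_charFun.1 hclt.tendsto 1
  have hvar : Var[X 0; Pr] = t.ofLp ⬝ᵥ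
      (Matrix.of fun i j => ∫ ω, ξ 0 ω i * ξ 0 ω j ∂Pr).mulVec t.ofLp := by
    rw [dotProduct_mulVec_integral_coord hL2, variance_of_integral_eq_zero hX2.aemeasurable hX0]
  rw [charFun_multivariateGaussian (posSemidef_integral_coord hL2), ← hvar]
  simp only [ProbabilityMeasure.coe_mk, Measure.map_id, charFun_gaussianReal] at h1
  have hlim : Complex.exp ((inner ℝ t (0 : EuclideanSpace ℝ ι) : ℝ) * Complex.I
        - (Var[X 0; Pr] : ℝ) / 2) = Complex.exp (((1 : ℝ) : ℂ) * ((0 : ℝ) : ℂ) * Complex.I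
        - ((Var[X 0; Pr].toNNReal : ℝ) : ℂ) * ((1 : ℝ) : ℂ) ^ 2 / 2) := by
    rw [Real.coe_toNNReal _ (variance_nonneg _ _)]
    simp
  rw [hlim]
  refine h1.congr fun n => ?_
  have hm : AEMeasurable (fun ω => (√(n : ℝ))⁻¹ • ∑ i ∈ Finset.range n, ξ i ω) Pr :=
    (Finset.aemeasurable_fun_sum _ fun i _ => (hident i).aemeasurable_fst).fun_const_smul _
  have hm' : AEMeasurable (fun ω => (√(n : ℝ))⁻¹ * (∑ i ∈ Finset.range n, X i ω - n * ∫ ω, X 0 ω ∂Pr))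
      Pr := hclt.forall_aemeasurable n
  rw [charFun_apply, charFun_apply, integral_map hm' (by fun_prop), integral_map hm (by fun_prop)]
  refine integral_congr_ae (ae_of_all _ fun ω => ?_)
  simp [hX0, X, sum_inner, real_inner_smul_left]

/-- Characteristic functions that converge pointwise to a function continuous at zero come from a
tight sequence; a compact set carrying most of the mass is bounded. -/
lemma isTightMeasureSet_inv_sqrt_smul_sum [IsProbabilityMeasure Pr]
    {ξ : ℕ → Ω → EuclideanSpace ℝ ι} (hindep : iIndepFun ξ Pr)
    (hident : ∀ i, IdentDistrib (ξ i) (ξ 0) Pr Pr) (hL2 : MemLp (ξ 0) 2 Pr)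
    (hmean : ∫ ω, ξ 0 ω ∂Pr = 0) {η : ENNReal} (hη : 0 < η) :
    ∃ C : ℝ, 0 < C ∧ ∀ n : ℕ,
      Pr {ω | ¬ ‖(√(n : ℝ))⁻¹ • ∑ i ∈ Finset.range n, ξ i ω‖ ≤ C} ≤ η := by
  have hm : ∀ n : ℕ, AEMeasurable (fun ω => (√(n : ℝ))⁻¹ • ∑ i ∈ Finset.range n, ξ i ω) Pr :=
    fun n => (Finset.aemeasurable_fun_sum _ fun i _ => (hident i).aemeasurable_fst).fun_const_smul _
  have : ∀ n : ℕ, IsProbabilityMeasure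
      (Pr.map fun ω => (√(n : ℝ))⁻¹ • ∑ i ∈ Finset.range n, ξ i ω) :=
    fun n => Measure.isProbabilityMeasure_map (hm n)
  have htight := isTightMeasureSet_of_tendsto_charFun
    (μ := fun n : ℕ => Pr.map fun ω => (√(n : ℝ))⁻¹ • ∑ i ∈ Finset.range n, ξ i ω)
    (f := charFun (multivariateGaussian 0
        (Matrix.of fun i j => ∫ ω, ξ 0 ω i * ξ 0 ω j ∂Pr)))
    continuous_charFun.continuousAt
    (tendsto_charFun_inv_sqrt_smul_sum hindep hident hL2 hmean)
  rw [isTightMeasureSet_iff_exists_isCompact_measure_compl_le] at htight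
  obtain ⟨Kc, hKc, hle⟩ := htight η hη
  obtain ⟨C, hC⟩ := hKc.isBounded.exists_norm_le
  refine ⟨max C 1, by positivity, fun n => ?_⟩
  have h1 := hle _ (Set.mem_range_self n)
  rw [Measure.map_apply_of_aemeasurable (hm n) hKc.measurableSet.compl] at h1
  refine (measure_mono ?_).trans h1
  intro ω hω hmem
  exact hω ((hC _ hmem).trans (le_max_left _ _))

end CentralLimit

/-! ### Estimating equations: existence, uniqueness and asymptotic normality of roots -/

section EstimatingEquations

variable {Ω T : Type*} [MeasurableSpace Ω] [MeasurableSpace T] {Pr : Measure Ω}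

lemma sum_eq_zero_iff_mean_eq_zero {E : Type*} [NormedAddCommGroup E] [NormedSpace ℝ E]
    (f : ℕ → E) (n : ℕ) :
    ∑ i ∈ Finset.range n, f i = 0 ↔ (n : ℝ)⁻¹ • ∑ i ∈ Finset.range n, f i = 0 := by
  rcases Nat.eq_zero_or_pos n with rfl | hn
  · simp
  · have : (n : ℝ)⁻¹ ≠ 0 := by positivity
    simp [this]

/-- If the empirical Jacobians converge uniformly in probability then, near `θ₀`, the estimating
function is approximately linear with high probability. -/
lemma exists_radius_approximates [IsProbabilityMeasure Pr]
    {T E : Type*} [NormedAddCommGroup E] [NormedSpace ℝ E] {O : ℕ → Ω → T} {s : E → T → E}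
    {N : Set E} (hN : IsOpen N) {θ₀ : E} (hθ₀ : θ₀ ∈ N)
    (hC1 : ∀ i, ∀ᵐ ω ∂Pr, ContDiffOn ℝ 1 (fun θ => s θ (O i ω)) N)
    {J : E → E →L[ℝ] E}
    (hJ : ∀ ε : ℝ, 0 < ε → Tendsto (fun n : ℕ => Pr {ω | ∃ θ ∈ N,
      ε ≤ ‖(n : ℝ)⁻¹ • ∑ i ∈ Finset.range n, fderiv ℝ (fun ϑ => s ϑ (O i ω)) θ - J θ‖})
      atTop (𝓝 0)) {ε : ℝ} (hε : 0 < ε) :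
    ∃ r : ℝ, 0 < r ∧ Metric.ball θ₀ r ⊆ N ∧ WithHighProb Pr (fun n ω =>
      ∀ x ∈ Metric.ball θ₀ r, ∀ y ∈ Metric.ball θ₀ r,
        ‖(n : ℝ)⁻¹ • ∑ i ∈ Finset.range n, s x (O i ω)
          - (n : ℝ)⁻¹ • ∑ i ∈ Finset.range n, s y (O i ω) - J θ₀ (x - y)‖ ≤ ε * ‖x - y‖) := by
  have hall : ∀ᵐ ω ∂Pr, ∀ i, ContDiffOn ℝ 1 (fun θ => s θ (O i ω)) N := ae_all_iff.2 hC1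
  have hW : WithHighProb Pr (fun n ω => (∀ θ ∈ N,
      ‖(n : ℝ)⁻¹ • ∑ i ∈ Finset.range n, fderiv ℝ (fun ϑ => s ϑ (O i ω)) θ - J θ‖ < ε / 4) ∧
      ∀ i, ContDiffOn ℝ 1 (fun θ => s θ (O i ω)) N) := by
    refine WithHighProb.and ?_ (WithHighProb.of_ae fun _ => hall)
    have h1 := hJ (ε / 4) (by positivity)
    refine WithHighProb.mono (p := fun (n : ℕ) ω => ¬ ∃ θ ∈ N, ε / 4 ≤
      ‖(n : ℝ)⁻¹ • ∑ i ∈ Finset.range n, fderiv ℝ (fun ϑ => s ϑ (O i ω)) θ - J θ‖) ?_ ?_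
    · simpa only [WithHighProb, not_not] using h1
    · intro n ω h
      push Not at h
      exact h
  -- Continuity of `J` at `θ₀` is not assumed. One outcome with `C¹` summands, whose continuous
  -- empirical Jacobian is within `ε/4` of `J` on all of `N`, bounds the oscillation of `J` by three
  -- times `ε/4`.
  obtain ⟨r, hr, hrN, hrJ⟩ : ∃ r : ℝ, 0 < r ∧ Metric.ball θ₀ r ⊆ N ∧
      ∀ θ ∈ Metric.ball θ₀ r, ‖J θ - J θ₀‖ < 3 * (ε / 4) := by
    obtain ⟨n, ω, h1, h2⟩ := hW.exists
    have hcont : ContinuousAt (fun θ => (n : ℝ)⁻¹ • ∑ i ∈ Finset.range n,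
        fderiv ℝ (fun ϑ => s ϑ (O i ω)) θ) θ₀ := by
      refine ContinuousAt.const_smul (g := fun θ => ∑ i ∈ Finset.range n,
        fderiv ℝ (fun ϑ => s ϑ (O i ω)) θ) (tendsto_finsetSum _ fun i _ => ?_)
        (n : ℝ)⁻¹
      exact ((h2 i).continuousOn_fderiv_of_isOpen hN le_rfl).continuousAt (hN.mem_nhds hθ₀)
    obtain ⟨r, hr, hball⟩ := Metric.eventually_nhds_iff_ball.1
      ((Metric.tendsto_nhds.1 hcont (ε / 4) (by positivity)).and (hN.mem_nhds hθ₀))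
    refine ⟨r, hr, fun θ hθ => (hball θ hθ).2, fun θ hθ => ?_⟩
    have hd := (hball θ hθ).1
    rw [dist_eq_norm] at hd
    have ha := h1 θ (hball θ hθ).2
    have hb := h1 θ₀ hθ₀
    set D := fun θ => (n : ℝ)⁻¹ • ∑ i ∈ Finset.range n, fderiv ℝ (fun ϑ => s ϑ (O i ω)) θ
    have : J θ - J θ₀ = (D θ - D θ₀) - (D θ - J θ) + (D θ₀ - J θ₀) := by abel
    rw [this]
    calc _ ≤ ‖D θ - D θ₀‖ + ‖D θ - J θ‖ + ‖D θ₀ - J θ₀‖ :=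
          (norm_add_le _ _).trans (add_le_add_left (norm_sub_le _ _) _)
      _ < ε / 4 + ε / 4 + ε / 4 := by gcongr
      _ = _ := by ring
  refine ⟨r, hr, hrN, hW.mono ?_⟩
  rintro n ω ⟨h1, h2⟩ x hx y hy
  have hdiff : ∀ θ ∈ Metric.ball θ₀ r, HasFDerivAt
      (fun ϑ => (n : ℝ)⁻¹ • ∑ i ∈ Finset.range n, s ϑ (O i ω))
      ((n : ℝ)⁻¹ • ∑ i ∈ Finset.range n, fderiv ℝ (fun ϑ => s ϑ (O i ω)) θ) θ := by
    intro θ hθ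
    refine HasFDerivAt.fun_const_smul (HasFDerivAt.fun_sum fun i _ => ?_) _
    exact (((h2 i).contDiffAt (hN.mem_nhds (hrN hθ))).differentiableAt one_ne_zero).hasFDerivAt
  -- Mean value inequality on the convex ball: the empirical Jacobian differs from `J θ₀` by at most
  -- `ε/4 + 3ε/4`.
  refine (convex_ball θ₀ r).norm_image_sub_le_of_norm_hasFDerivWithin_le'
    (fun θ hθ => (hdiff θ hθ).hasFDerivWithinAt) (fun θ hθ => ?_) hy hx
  have ha := (h1 θ (hrN hθ)).le
  have hb := (hrJ θ hθ).le
  calc _ ≤ _ := norm_sub_le_norm_sub_add_norm_sub _ (J θ) _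
    _ ≤ ε / 4 + 3 * (ε / 4) := add_le_add ha hb
    _ = ε := by ring

variable {ι : Type*} [Fintype ι] {P : Measure T} {O : ℕ → Ω → T}

lemma ae_sample_of_ae
    (hlaw : ∀ i, HasLaw (O i) P Pr)
    {q : T → Prop} (h : ∀ᵐ o ∂P, q o) : ∀ᵐ ω ∂Pr, ∀ i, q (O i ω) := by
  refine ae_all_iff.2 fun i => ?_
  have h' := h
  rw [← (hlaw i).map_eq] at h'
  exact ae_of_ae_map (hlaw i).aemeasurable h'

lemma iIndepFun_comp_sample
    (hindep : iIndepFun O Pr) (hlaw : ∀ i, HasLaw (O i) P Pr)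
    {S : Type*} [MeasurableSpace S] {f : T → S} (hf : AEMeasurable f P) :
    iIndepFun (fun i ω => f (O i ω)) Pr ∧
      ∀ i, IdentDistrib (fun ω => f (O i ω)) (fun ω => f (O 0 ω)) Pr Pr := by
  refine ⟨hindep.comp₀ (fun _ => f) (fun i => (hlaw i).aemeasurable)
    fun i => by rwa [(hlaw i).map_eq], fun i => ?_⟩
  have hid : IdentDistrib (O i) (O 0) Pr Pr :=
    ⟨(hlaw i).aemeasurable, (hlaw 0).aemeasurable, by rw [(hlaw i).map_eq, (hlaw 0).map_eq]⟩
  exact hid.comp_of_aemeasurable (by rwa [(hlaw i).map_eq])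

lemma exists_bound_inv_sqrt_smul_sum [IsProbabilityMeasure Pr] [DecidableEq ι]
    (hindep : iIndepFun O Pr) (hlaw : ∀ i, HasLaw (O i) P Pr)
    {f : T → EuclideanSpace ℝ ι} (hf : MemLp f 2 P)
    (hmean : ∫ o, f o ∂P = 0) {η : ENNReal} (hη : 0 < η) :
    ∃ C : ℝ, 0 < C ∧ ∀ n : ℕ,
      Pr {ω | ¬ ‖(√(n : ℝ))⁻¹ • ∑ i ∈ Finset.range n, f (O i ω)‖ ≤ C} ≤ η := by
  have hP := (hlaw 0).map_eq
  have hm := hf.aestronglyMeasurable.aemeasurable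
  obtain ⟨h1, h2⟩ := iIndepFun_comp_sample hindep hlaw hm
  refine isTightMeasureSet_inv_sqrt_smul_sum h1 h2 ?_ ?_ hη
  · exact (hP ▸ hf).comp_of_map (hlaw 0).aemeasurable
  · rw [← hmean, ← hP, integral_map (hlaw 0).aemeasurable
      (by rw [hP]; exact hf.aestronglyMeasurable)]

lemma tendstoInDistribution_inv_sqrt_smul_sum [IsProbabilityMeasure Pr] [DecidableEq ι]
    (hindep : iIndepFun O Pr) (hlaw : ∀ i, HasLaw (O i) P Pr)
    {f : T → EuclideanSpace ℝ ι} (hf : MemLp f 2 P)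
    (hmean : ∫ o, f o ∂P = 0) :
    TendstoInDistribution (fun (n : ℕ) ω => (√(n : ℝ))⁻¹ • ∑ i ∈ Finset.range n, f (O i ω))
      atTop id (fun _ => Pr)
      (multivariateGaussian 0 (Matrix.of fun i j => ∫ o, f o i * f o j ∂P)) := by
  have hP := (hlaw 0).map_eq
  have hm := hf.aestronglyMeasurable.aemeasurable
  have hm0 : AEMeasurable f (Pr.map (O 0)) := by rwa [hP]
  obtain ⟨h1, h2⟩ := iIndepFun_comp_sample hindep hlaw hm
  have h3 : MemLp (fun ω => f (O 0 ω)) 2 Pr := (hP ▸ hf).comp_of_map (hlaw 0).aemeasurable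
  have h4 : ∫ ω, f (O 0 ω) ∂Pr = 0 := by
    rw [← hmean, ← hP, integral_map (hlaw 0).aemeasurable hm0.aestronglyMeasurable]
  have hmat : (Matrix.of fun i j => ∫ o, f o i * f o j ∂P)
      = Matrix.of fun i j => ∫ ω, f (O 0 ω) i * f (O 0 ω) j ∂Pr := by
    ext i j
    simp only [Matrix.of_apply]
    have hc : AEMeasurable (fun o => f o i * f o j) (Pr.map (O 0)) := by fun_prop
    rw [← hP, integral_map (hlaw 0).aemeasurable hc.aestronglyMeasurable]
  refine ⟨fun n => (Finset.aemeasurable_fun_sum _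
    fun i _ => (h2 i).aemeasurable_fst).fun_const_smul _, by fun_prop, ?_⟩
  refine ProbabilityMeasure.tendsto_iff_tendsto_charFun.2 fun t => ?_
  simp only [ProbabilityMeasure.coe_mk, Measure.map_id, hmat]
  exact tendsto_charFun_inv_sqrt_smul_sum h1 h2 h3 h4 t

/-- The law of large numbers, in probability. -/
lemma withHighProb_norm_mean_le [IsProbabilityMeasure Pr] [DecidableEq ι]
    (hindep : iIndepFun O Pr) (hlaw : ∀ i, HasLaw (O i) P Pr)
    {f : T → EuclideanSpace ℝ ι} (hf : MemLp f 2 P)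
    (hmean : ∫ o, f o ∂P = 0) {ε : ℝ} (hε : 0 < ε) :
    WithHighProb Pr (fun n ω => ‖(n : ℝ)⁻¹ • ∑ i ∈ Finset.range n, f (O i ω)‖ ≤ ε) := by
  rw [WithHighProb, ENNReal.tendsto_nhds_zero]
  intro η hη
  obtain ⟨C, hC, hle⟩ := exists_bound_inv_sqrt_smul_sum hindep hlaw hf hmean hη
  have hlim : Tendsto (fun n : ℕ => (√(n : ℝ))⁻¹ * C) atTop (𝓝 0) := by
    simpa using (tendsto_inv_atTop_zero.comp
      (Real.tendsto_sqrt_atTop.comp tendsto_natCast_atTop_atTop)).mul_const C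
  filter_upwards [hlim.eventually_lt_const hε] with n hn
  refine (measure_mono ?_).trans (hle n)
  intro ω hω hmem
  refine hω (le_trans ?_ hn.le)
  -- The mean is `n^{-1/2}` times the normalised sum, which is at most `C` off an event of
  -- probability at most `η`.
  have : (n : ℝ)⁻¹ = (√(n : ℝ))⁻¹ * (√(n : ℝ))⁻¹ := by
    rw [← mul_inv, Real.mul_self_sqrt (Nat.cast_nonneg n)]
  rw [this, mul_smul, norm_smul, Real.norm_of_nonneg (by positivity)]
  gcongr

variable {s : EuclideanSpace ℝ ι → T → EuclideanSpace ℝ ι} {N : Set (EuclideanSpace ℝ ι)}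
  {θ₀ : EuclideanSpace ℝ ι}

/-- Roots of a uniquely solvable estimating equation can be selected measurably. -/
lemma exists_measurable_estimator
    (hlaw : ∀ i, HasLaw (O i) P Pr)
    {r K : ℝ} (hr : 0 < r) (hNr : Metric.ball θ₀ r ⊆ N)
    (hmeas : ∀ θ ∈ N, AEMeasurable (s θ) P)
    (hC1 : ∀ᵐ o ∂P, ContDiffOn ℝ 1 (fun θ => s θ o) N)
    (hgood : WithHighProb Pr (fun n ω => (∀ x ∈ Metric.ball θ₀ r, ∀ y ∈ Metric.ball θ₀ r,
        ‖x - y‖ ≤ K * ‖(n : ℝ)⁻¹ • ∑ i ∈ Finset.range n, s x (O i ω)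
          - (n : ℝ)⁻¹ • ∑ i ∈ Finset.range n, s y (O i ω)‖) ∧
      ∃ θ ∈ Metric.ball θ₀ r, ∑ i ∈ Finset.range n, s θ (O i ω) = 0)) :
    ∃ est : (n : ℕ) → (Fin n → T) → EuclideanSpace ℝ ι, (∀ n, Measurable (est n)) ∧
      WithHighProb Pr (fun n ω => est n (fun i => O i ω) ∈ Metric.ball θ₀ r ∧
        ∑ i ∈ Finset.range n, s (est n (fun i => O i ω)) (O i ω) = 0) := by
  have : Nonempty (Metric.ball θ₀ r) := ⟨⟨θ₀, Metric.mem_ball_self hr⟩⟩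
  -- A countable dense set of parameters allows the estimating functions to be replaced by
  -- measurable versions off a single null set. Continuity in the parameter makes values near the
  -- root arbitrarily small along it.
  let d : ℕ → Metric.ball θ₀ r := TopologicalSpace.denseSeq _
  have hd : DenseRange d := TopologicalSpace.denseRange_denseSeq _
  have hdm : ∀ j, AEMeasurable (s (d j)) P := fun j => hmeas _ (hNr (d j).2)
  let m : ℕ → T → EuclideanSpace ℝ ι := fun j => (hdm j).mk
  have hmm : ∀ j, Measurable (m j) := fun j => (hdm j).measurable_mk
  have hms : ∀ᵐ o ∂P, ∀ j, s (d j) o = m j o := ae_all_iff.2 fun j => (hdm j).ae_eq_mk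
  have hsel : ∀ n : ℕ, ∃ est : (Fin n → T) → EuclideanSpace ℝ ι, Measurable est ∧ ∀ a θ C,
      (∀ j, ‖(d j : EuclideanSpace ℝ ι) - θ‖ ≤ C * ‖(n : ℝ)⁻¹ • ∑ i, m j (a i)‖) →
      (∀ ε : ℝ, 0 < ε → ∃ j, ‖(n : ℝ)⁻¹ • ∑ i, m j (a i)‖ < ε) → est a = θ := by
    intro n
    refine exists_measurable_selection (fun j => (d j : EuclideanSpace ℝ ι))
      (g := fun j (a : Fin n → T) => (n : ℝ)⁻¹ • ∑ i, m j (a i)) fun j => ?_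
    have h : Measurable fun a : Fin n → T => ∑ i, m j (a i) :=
      Finset.measurable_fun_sum _ fun i _ => (hmm j).comp (measurable_pi_apply i)
    exact h.const_smul (n : ℝ)⁻¹
  choose est hest hroot using hsel
  refine ⟨est, hest, hgood.mono_ae fun n => ?_⟩
  filter_upwards [ae_sample_of_ae hlaw hC1, ae_sample_of_ae hlaw hms] with ω h1 h2
  rintro ⟨hlip, θ, hθ, hzero⟩
  have hsum : ∀ j, ∑ i : Fin n, m j (O i ω) = ∑ i ∈ Finset.range n, s (d j) (O i ω) := by
    intro j
    rw [Finset.sum_range]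
    exact Finset.sum_congr rfl fun i _ => (h2 i j).symm
  have hz := (sum_eq_zero_iff_mean_eq_zero _ _).1 hzero
  have heq : est n (fun i => O i ω) = θ := by
    refine hroot n _ θ K ?_ ?_
    · intro j
      have := hlip _ (d j).2 θ hθ
      rwa [hz, sub_zero, ← hsum j] at this
    · intro ε hε
      have hcont : ContinuousOn
          (fun ϑ => (n : ℝ)⁻¹ • ∑ i ∈ Finset.range n, s ϑ (O i ω)) (Metric.ball θ₀ r) :=
        ContinuousOn.fun_const_smul (g := fun ϑ => ∑ i ∈ Finset.range n, s ϑ (O i ω))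
          (continuousOn_finsetSum _ fun i _ => (h1 i).continuousOn.mono hNr) _
      have hcont' := (continuousOn_iff_continuous_domRestrict.1 hcont).norm
      obtain ⟨j, hj⟩ := hd.exists_mem_open (hcont'.isOpen_preimage _ (isOpen_gt' ε))
        ⟨⟨θ, hθ⟩, by
          simpa [Set.domRestrict_apply, hzero] using hε⟩
      refine ⟨j, ?_⟩
      rw [hsum j]
      exact hj
  rw [heq]
  exact ⟨hθ, hzero⟩

/-- Estimating equations with a uniformly convergent, asymptotically invertible Jacobian: local
existence and uniqueness of a root, consistency and asymptotic normality. -/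
theorem estimatingEquation_asymptotics [IsProbabilityMeasure Pr] [DecidableEq ι]
    (hindep : iIndepFun O Pr) (hlaw : ∀ i, HasLaw (O i) P Pr)
    (hN : IsOpen N) (hθ₀ : θ₀ ∈ N)
    (hmeas : ∀ θ ∈ N, AEMeasurable (s θ) P)
    (hsq : MemLp (s θ₀) 2 P) (hmean : ∫ o, s θ₀ o ∂P = 0)
    (hC1 : ∀ᵐ o ∂P, ContDiffOn ℝ 1 (fun θ => s θ o) N)
    {J : EuclideanSpace ℝ ι → EuclideanSpace ℝ ι →L[ℝ] EuclideanSpace ℝ ι}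
    (hJ : ∀ ε : ℝ, 0 < ε → Tendsto (fun n : ℕ => Pr {ω | ∃ θ ∈ N,
      ε ≤ ‖(n : ℝ)⁻¹ • ∑ i ∈ Finset.range n, fderiv ℝ (fun ϑ => s ϑ (O i ω)) θ - J θ‖})
      atTop (𝓝 0))
    {B : EuclideanSpace ℝ ι →L[ℝ] EuclideanSpace ℝ ι} (hAB : ∀ x, J θ₀ (B x) = x)
    (hBA : ∀ x, B (J θ₀ x) = x) :
    ∃ N₀ : Set (EuclideanSpace ℝ ι), IsOpen N₀ ∧ θ₀ ∈ N₀ ∧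
      Tendsto (fun n : ℕ => Pr {ω | ¬ ∃! θ, θ ∈ N₀ ∧
        ∑ i ∈ Finset.range n, s θ (O i ω) = 0}) atTop (𝓝 0) ∧
      (∃ est : (n : ℕ) → (Fin n → T) → EuclideanSpace ℝ ι, (∀ n, Measurable (est n)) ∧
        Tendsto (fun n : ℕ => Pr {ω | ¬ (est n (fun i => O i ω) ∈ N₀ ∧
          ∑ i ∈ Finset.range n, s (est n (fun i => O i ω)) (O i ω) = 0)}) atTop (𝓝 0)) ∧
      ∀ θhat : ℕ → Ω → EuclideanSpace ℝ ι, (∀ n, AEMeasurable (θhat n) Pr) →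
        Tendsto (fun n : ℕ => Pr {ω | ¬ (θhat n ω ∈ N₀ ∧
          ∑ i ∈ Finset.range n, s (θhat n ω) (O i ω) = 0)}) atTop (𝓝 0) →
        TendstoInMeasure Pr θhat atTop (fun _ => θ₀) ∧
        TendstoInDistribution (fun (n : ℕ) ω => √(n : ℝ) • (θhat n ω - θ₀)) atTop id
          (fun _ => Pr)
          (multivariateGaussian 0
            (Matrix.of fun i j => ∫ o, B (s θ₀ o) i * B (s θ₀ o) j ∂P)) := by
  have hC1' : ∀ i, ∀ᵐ ω ∂Pr, ContDiffOn ℝ 1 (fun θ => s θ (O i ω)) N :=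
    ae_all_iff.1 (ae_sample_of_ae hlaw hC1)
  -- The added `1` keeps `K` positive without discussing `‖B‖`.
  set K : ℝ := ‖B‖ + 1 with hKdef
  have hK : 0 < K := by positivity
  have hB : ∀ x, ‖B x‖ ≤ K * ‖x‖ := fun x =>
    (B.le_opNorm x).trans (by gcongr; linarith)
  obtain ⟨r, hr, hrN, happ⟩ := exists_radius_approximates hN hθ₀ hC1' hJ
    (ε := 1 / (2 * K)) (by positivity)
  set A := J θ₀
  -- the zero is controlled by the value of the estimating function
  have hlip : WithHighProb Pr (fun n ω => ∀ x ∈ Metric.ball θ₀ r, ∀ y ∈ Metric.ball θ₀ r,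
      ‖x - y‖ ≤ 2 * K * ‖(n : ℝ)⁻¹ • ∑ i ∈ Finset.range n, s x (O i ω)
          - (n : ℝ)⁻¹ • ∑ i ∈ Finset.range n, s y (O i ω)‖) :=
    happ.mono fun n ω h x hx y hy => norm_sub_le_of_approximates
      (G := fun ϑ => (n : ℝ)⁻¹ • ∑ i ∈ Finset.range n, s ϑ (O i ω)) hK hB hBA h hx hy
  have hex : WithHighProb Pr (fun n ω => ∃ θ ∈ Metric.ball θ₀ r,
      ∑ i ∈ Finset.range n, s θ (O i ω) = 0) := by
    refine (happ.and (withHighProb_norm_mean_le hindep hlaw hsq hmean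
      (ε := r / (4 * K)) (by positivity))).mono ?_
    rintro n ω ⟨h1, h2⟩
    obtain ⟨θ, hθ, h⟩ := exists_root_of_approximates
      (G := fun ϑ => (n : ℝ)⁻¹ • ∑ i ∈ Finset.range n, s ϑ (O i ω)) hK hr hB hAB h1 h2
    exact ⟨θ, hθ, (sum_eq_zero_iff_mean_eq_zero _ _).2 h⟩
  refine ⟨Metric.ball θ₀ r, Metric.isOpen_ball, Metric.mem_ball_self hr, ?_,
    exists_measurable_estimator hlaw hr hrN hmeas hC1 (hlip.and hex), ?_⟩
  · refine (hlip.and hex).mono ?_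
    rintro n ω ⟨h1, θ, hθ, h2⟩
    refine ⟨θ, ⟨hθ, h2⟩, ?_⟩
    rintro ϑ ⟨hϑ, h3⟩
    have := h1 ϑ hϑ θ hθ
    rw [(sum_eq_zero_iff_mean_eq_zero _ _).1 h2, (sum_eq_zero_iff_mean_eq_zero _ _).1 h3,
      sub_zero, norm_zero, mul_zero] at this
    exact sub_eq_zero.1 (norm_le_zero_iff.1 this)
  · intro θhat hθm hroot
    change WithHighProb Pr (fun n ω => θhat n ω ∈ Metric.ball θ₀ r ∧
      ∑ i ∈ Finset.range n, s (θhat n ω) (O i ω) = 0) at hroot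
    have hθ₀r : θ₀ ∈ Metric.ball θ₀ r := Metric.mem_ball_self hr
    -- Comparing the root with `θ₀` itself: this one bound gives consistency and the rate
    -- `n^{-1/2}`.
    have hdist : WithHighProb Pr (fun n ω =>
        ‖θhat n ω - θ₀‖ ≤ 2 * K * ‖(n : ℝ)⁻¹ • ∑ i ∈ Finset.range n, s θ₀ (O i ω)‖) := by
      refine (hlip.and hroot).mono ?_
      rintro n ω ⟨h1, h2, h3⟩
      have := h1 _ h2 _ hθ₀r
      rwa [(sum_eq_zero_iff_mean_eq_zero _ _).1 h3, zero_sub, norm_neg] at this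
    have hcons : ∀ ε : ℝ, 0 < ε → WithHighProb Pr (fun n ω => ‖θhat n ω - θ₀‖ < ε) := by
      intro ε hε
      refine (hdist.and (withHighProb_norm_mean_le hindep hlaw hsq hmean
        (ε := ε / (4 * K)) (by positivity))).mono ?_
      rintro n ω ⟨h1, h2⟩
      calc _ ≤ _ := h1
        _ ≤ 2 * K * (ε / (4 * K)) := by gcongr
        _ = ε / 2 := by field_simp; ring
        _ < ε := by linarith
    refine ⟨tendstoInMeasure_iff_norm.2 fun ε hε => ?_, ?_⟩
    · simpa only [WithHighProb, not_lt] using hcons ε hε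
    have hBsq : MemLp (fun o => -B (s θ₀ o)) 2 P := (B.comp_memLp' hsq).neg
    have hBmean : ∫ o, -B (s θ₀ o) ∂P = 0 := by
      have : IsProbabilityMeasure P := by
        rw [← (hlaw 0).map_eq]; exact Measure.isProbabilityMeasure_map (hlaw 0).aemeasurable
      rw [integral_neg, B.integral_comp_comm (hsq.integrable one_le_two), hmean, map_zero, neg_zero]
    have hclt := tendstoInDistribution_inv_sqrt_smul_sum hindep hlaw hBsq hBmean
    simp only [PiLp.neg_apply, neg_mul_neg] at hclt
    -- Slutsky: it remains to show that the difference from the linear term `-n^{-1/2} ∑ B s(O_i)`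
    -- tends to zero in probability.
    refine tendstoInDistribution_of_tendstoInMeasure_sub _ _ hclt ?_
      fun n => ((hθm n).sub_const _).fun_const_smul _
    refine tendstoInMeasure_iff_norm.2 fun δ hδ => ?_
    rw [ENNReal.tendsto_nhds_zero]
    intro η hη
    have hη2 : 0 < η / 2 := ENNReal.half_pos hη.ne'
    obtain ⟨C, hC, hle⟩ := exists_bound_inv_sqrt_smul_sum hindep hlaw hsq hmean hη2
    -- Chosen so that the rescaled linearisation error, at most `K ε · 2 K C`, equals `δ/2 < δ`.
    set ε : ℝ := δ / (4 * K ^ 2 * C) with hε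
    have hεpos : 0 < ε := by positivity
    -- A second, smaller ball for the smaller error; consistency puts the root into it.
    obtain ⟨ρ, hρ, -, happρ⟩ := exists_radius_approximates hN hθ₀ hC1' hJ hεpos
    have hlin : WithHighProb Pr (fun n ω =>
        ‖θhat n ω - θ₀ + B ((n : ℝ)⁻¹ • ∑ i ∈ Finset.range n, s θ₀ (O i ω))‖ ≤
          K * ε * (2 * K * ‖(n : ℝ)⁻¹ • ∑ i ∈ Finset.range n, s θ₀ (O i ω)‖)) := by
      refine ((hdist.and hroot).and (happρ.and (hcons ρ hρ))).mono ?_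
      rintro n ω ⟨⟨h1, -, h2⟩, h3, h4⟩
      have h5 := h3 (θhat n ω) (mem_ball_iff_norm.2 h4) θ₀ (Metric.mem_ball_self hρ)
      rw [(sum_eq_zero_iff_mean_eq_zero _ _).1 h2] at h5
      have h6 : θhat n ω - θ₀ + B ((n : ℝ)⁻¹ • ∑ i ∈ Finset.range n, s θ₀ (O i ω)) =
          - B (0 - (n : ℝ)⁻¹ • ∑ i ∈ Finset.range n, s θ₀ (O i ω) - A (θhat n ω - θ₀)) := by
        rw [map_sub, map_sub B, hBA, map_zero]
        abel
      rw [h6, norm_neg]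
      calc _ ≤ _ := hB _
        _ ≤ K * (ε * ‖θhat n ω - θ₀‖) := by gcongr
        _ = K * ε * ‖θhat n ω - θ₀‖ := by ring
        _ ≤ _ := by gcongr
    filter_upwards [(ENNReal.tendsto_nhds_zero.1 hlin) _ hη2] with n hn
    calc Pr _ ≤ Pr ({ω | ¬ ‖(√(n : ℝ))⁻¹ • ∑ i ∈ Finset.range n, s θ₀ (O i ω)‖ ≤ C} ∪
          {ω | ¬ ‖θhat n ω - θ₀ + B ((n : ℝ)⁻¹ • ∑ i ∈ Finset.range n, s θ₀ (O i ω))‖ ≤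
          K * ε * (2 * K * ‖(n : ℝ)⁻¹ • ∑ i ∈ Finset.range n, s θ₀ (O i ω)‖)}) := by
          refine measure_mono ?_
          intro ω hω
          by_contra hcon
          simp only [Set.mem_union, Set.mem_ofPred_eq, not_or, not_not] at hcon
          obtain ⟨h1, h2⟩ := hcon
          have hsqrt : (√(n : ℝ))⁻¹ = √(n : ℝ) * (n : ℝ)⁻¹ := by
            rw [← div_eq_mul_inv, Real.sqrt_div_self', one_div]
          have h3 : √(n : ℝ) • (θhat n ω - θ₀)
              - (√(n : ℝ))⁻¹ • ∑ i ∈ Finset.range n, -B (s θ₀ (O i ω)) = √(n : ℝ) •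
              (θhat n ω - θ₀ + B ((n : ℝ)⁻¹ • ∑ i ∈ Finset.range n, s θ₀ (O i ω))) := by
            rw [hsqrt, Finset.sum_neg_distrib, map_smul, map_sum, smul_add, mul_smul, smul_neg,
              smul_neg, sub_neg_eq_add]
          have h4 : δ ≤ ‖√(n : ℝ) • (θhat n ω - θ₀)
              - (√(n : ℝ))⁻¹ • ∑ i ∈ Finset.range n, -B (s θ₀ (O i ω))‖ := by
            simpa using hω
          rw [h3, norm_smul, Real.norm_of_nonneg (Real.sqrt_nonneg _)] at h4
          rw [hsqrt, mul_smul, norm_smul, Real.norm_of_nonneg (Real.sqrt_nonneg _)] at h1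
          have h5 : δ ≤ K * ε * (2 * K * C) := by
            calc δ ≤ _ := h4
              _ ≤ √(n : ℝ) * (K * ε *
                  (2 * K * ‖(n : ℝ)⁻¹ • ∑ i ∈ Finset.range n, s θ₀ (O i ω)‖)) := by gcongr
              _ = K * ε * (2 * K *
                  (√(n : ℝ) * ‖(n : ℝ)⁻¹ • ∑ i ∈ Finset.range n, s θ₀ (O i ω)‖)) := by ring
              _ ≤ _ := by gcongr
          have h6 : K * ε * (2 * K * C) = δ / 2 := by
            rw [hε]; field_simp; ring
          linarith
      _ ≤ η / 2 + η / 2 := (measure_union_le _ _).trans (add_le_add (hle n) hn)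
      _ = η := ENNReal.add_halves η

end EstimatingEquations

/-! ### Exponential families: normalisation and smoothness -/

namespace ExpFamily

variable (E : ExpFamily)

lemma measurable_cumulant : Measurable E.cumulant := by
  have h : Measurable (mgf id E.base) := by
    have : StronglyMeasurable (Function.uncurry fun t x : ℝ => Real.exp (t * id x)) := by
      refine Measurable.stronglyMeasurable ?_
      simp only [id]
      fun_prop
    exact this.integral_prod_right.measurable
  have h2 : Measurable (cgf id E.base) := Real.measurable_log.comp h
  unfold cumulant
  fun_prop

lemma density_pos (η y : ℝ) : 0 < E.density η y := Real.exp_pos _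

/-- The factor `exp(-b(η)/φ)` is the reciprocal of the moment generating function of the base
measure at `η/φ`, which is finite on the natural domain and positive since the base measure is
nonzero. -/
lemma lintegral_density {η : ℝ} (hη : η ∈ E.natDomain) :
    ∫⁻ y, ENNReal.ofReal (E.density η y) ∂E.base = 1 := by
  have hint : Integrable (fun y => Real.exp (η / E.disp * id y)) E.base := hη
  have : NeZero E.base := ⟨E.base_ne_zero⟩
  have hφ := E.disp_pos.ne'
  have h : ∀ y, E.density η y =
      Real.exp (η / E.disp * id y) * (mgf id E.base (η / E.disp))⁻¹ := by
    intro y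
    rw [← exp_cgf hint, ← Real.exp_neg, ← Real.exp_add, density, cumulant]
    congr 1
    simp only [id]
    field_simp
    ring
  simp_rw [h]
  rw [← ofReal_integral_eq_lintegral_ofReal (hint.mul_const _)
    (ae_of_all _ fun y => mul_nonneg (Real.exp_pos _).le (inv_nonneg.2 mgf_nonneg)),
    integral_mul_const]
  change ENNReal.ofReal (mgf id E.base (η / E.disp) * _) = 1
  rw [mul_inv_cancel₀ (mgf_pos' E.base_ne_zero hint).ne', ENNReal.ofReal_one]

/-- The cumulant generating function is analytic in the interior of its domain; dividing by the
dispersion is a homeomorphism and so respects interiors. -/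
lemma differentiableAt_cumulant {η : ℝ} (hη : η ∈ interior E.natDomain) :
    DifferentiableAt ℝ E.cumulant η := by
  have hφ := E.disp_pos.ne'
  have hmem : η / E.disp ∈ interior (integrableExpSet id E.base) := by
    have hpre : E.natDomain = (Homeomorph.mulRight₀ E.disp⁻¹ (inv_ne_zero hφ)) ⁻¹'
        integrableExpSet id E.base := by
      ext x
      simp [natDomain, div_eq_mul_inv]
    rw [hpre, ← Homeomorph.preimage_interior] at hη
    simpa [div_eq_mul_inv] using hη
  have := (analyticAt_cgf hmem).differentiableAt
  unfold cumulant
  exact (DifferentiableAt.fun_comp' η this (by fun_prop)).const_mul _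

end ExpFamily

/-! ### The full data law and its two disintegrations -/

namespace Model

variable {p : ℕ} (M : Model)

lemma density_pos (θ : Param p) (d : FullData p) : 0 < M.density θ d :=
  mul_pos (ExpFamily.density_pos _ _ _) (ExpFamily.density_pos _ _ _)

lemma measurable_treatmentPred (θ : Param p) : Measurable (M.treatmentPred θ) := by
  unfold treatmentPred
  fun_prop

lemma measurable_outcomePred (θ : Param p) : Measurable (M.outcomePred θ) := by
  unfold outcomePred
  fun_prop

@[fun_prop]
lemma measurable_density (θ : Param p) : Measurable (M.density θ) := by
  have h1 := M.treatment.measurable_cumulant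
  have h2 := M.outcome.measurable_cumulant
  have h3 := M.measurable_treatmentPred θ
  have h4 := M.measurable_outcomePred θ
  unfold density ExpFamily.density
  fun_prop

lemma measurable_obs : Measurable (obs : FullData p → Obs p) := by
  unfold obs
  fun_prop

/-- `(z, y)` is kept fixed and `u` is separated from the observed data. -/
def separateLatent (p : ℕ) : FullData p ≃ᵐ Obs p × ℝ where
  toFun d := (obs d, d.1.2)
  invFun q := ((q.1.1, q.2), q.1.2)
  left_inv _ := rfl
  right_inv _ := rfl
  measurable_toFun := by
    change Measurable fun d : FullData p => (obs d, d.1.2)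
    exact measurable_obs.prodMk (by fun_prop)
  measurable_invFun := by
    change Measurable fun q : Obs p × ℝ => ((q.1.1, q.2), q.1.2)
    fun_prop

/-- The conditional law of `U` given `X`, as a kernel on the observed data. -/
def latentKernel (G : Kernel (Cov p) ℝ) : Kernel (Obs p) ℝ := G.comap Prod.fst measurable_fst

instance (G : Kernel (Cov p) ℝ) [IsMarkovKernel G] : IsMarkovKernel (latentKernel G) := by
  unfold latentKernel; infer_instance

instance : SigmaFinite M.baseZY := by unfold baseZY; infer_instance

lemma baseZY_ne_zero : M.baseZY ≠ 0 := by
  rw [Ne, ← Measure.measure_univ_eq_zero, baseZY, ← Set.univ_prod_univ, Measure.prod_prod]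
  simp [ExpFamily.base_ne_zero]

variable (μX : Measure (Cov p)) [IsProbabilityMeasure μX] (G : Kernel (Cov p) ℝ) [IsMarkovKernel G]

instance : SigmaFinite (M.dominating μX G) := by unfold dominating; infer_instance

/-- Tonelli: given x, the law of u and the base measure of (z, y) form a product, so u may be
integrated first. This order is the one needed for Bayes' formula. -/
lemma measurePreserving_separateLatent : MeasurePreserving (separateLatent p)
    (M.dominating μX G) ((μX.prod M.baseZY) ⊗ₘ latentKernel G) := by
  refine ⟨(separateLatent p).measurable, ?_⟩
  refine Measure.ext_of_lintegral _ fun f hf => ?_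
  have h1 : Measurable fun d : FullData p => f ((separateLatent p) d) :=
    hf.comp (separateLatent p).measurable
  rw [lintegral_map hf (separateLatent p).measurable, dominating,
    lintegral_prod _ h1.aemeasurable, Measure.lintegral_compProd h1.lintegral_prod_right',
    Measure.lintegral_compProd hf, lintegral_prod _ hf.lintegral_kernel_prod_right'.aemeasurable]
  refine lintegral_congr fun x => ?_
  change ∫⁻ u, ∫⁻ zy, f ((x, zy), u) ∂M.baseZY ∂(G x) = ∫⁻ zy, ∫⁻ u, f ((x, zy), u) ∂(G x) ∂M.baseZY
  refine lintegral_lintegral_swap ?_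
  exact (hf.comp (by fun_prop : Measurable fun q : ℝ × (ℝ × ℝ) => ((x, q.2), q.1))).aemeasurable

lemma measurePreserving_obs :
    MeasurePreserving obs (M.dominating μX G) (μX.prod M.baseZY) := by
  refine ⟨measurable_obs, ?_⟩
  have h := (M.measurePreserving_separateLatent μX G).map_eq
  have h2 : (obs : FullData p → Obs p) = Prod.fst ∘ separateLatent p := rfl
  rw [h2, ← Measure.map_map measurable_fst (separateLatent p).measurable, h]
  exact Measure.fst_compProd _ _

lemma fullLaw_absolutelyContinuous (θ : Param p) : M.fullLaw μX G θ ≪ M.dominating μX G :=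
  withDensity_absolutelyContinuous _ _

/-- The density is an exponential and never vanishes, so almost everywhere statements pass freely
between the dominating measure and the law at any parameter. -/
lemma dominating_absolutelyContinuous (θ : Param p) : M.dominating μX G ≪ M.fullLaw μX G θ := by
  refine withDensity_absolutelyContinuous' (by fun_prop) (ae_of_all _ fun d => ?_)
  simpa using M.density_pos θ d

lemma obsLaw_absolutelyContinuous (θ : Param p) : M.obsLaw μX G θ ≪ μX.prod M.baseZY := by
  rw [← (M.measurePreserving_obs μX G).map_eq]
  exact (M.fullLaw_absolutelyContinuous μX G θ).map measurable_obs

section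

variable {V : Type*} [NormedAddCommGroup V] [NormedSpace ℝ V] {μX G}

lemma integrable_fullLaw_iff {θ : Param p} {h : FullData p → V} :
    Integrable h (M.fullLaw μX G θ) ↔
      Integrable (fun d => M.density θ d • h d) (M.dominating μX G) := by
  rw [fullLaw, integrable_withDensity_iff_integrable_smul' (by fun_prop)
    (ae_of_all _ fun _ => ENNReal.ofReal_lt_top)]
  simp_rw [ENNReal.toReal_ofReal (M.density_pos θ _).le]

lemma integral_fullLaw {θ : Param p} (h : FullData p → V) :
    ∫ d, h d ∂(M.fullLaw μX G θ) = ∫ d, M.density θ d • h d ∂(M.dominating μX G) := by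
  rw [fullLaw, integral_withDensity_eq_integral_toReal_smul (by fun_prop)
    (ae_of_all _ fun _ => ENNReal.ofReal_lt_top)]
  simp_rw [ENNReal.toReal_ofReal (M.density_pos θ _).le]

lemma integrable_fullLaw_iff_separate {θ : Param p} {h : FullData p → V} :
    Integrable h (M.fullLaw μX G θ) ↔
      Integrable (fun q : Obs p × ℝ => M.density θ ((q.1.1, q.2), q.1.2) • h ((q.1.1, q.2), q.1.2))
        ((μX.prod M.baseZY) ⊗ₘ latentKernel G) := by
  rw [M.integrable_fullLaw_iff]
  exact ((M.measurePreserving_separateLatent μX G).symm.integrable_comp_emb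
    (separateLatent p).symm.measurableEmbedding).symm

lemma integral_fullLaw_separate {θ : Param p} {h : FullData p → V}
    (hh : Integrable h (M.fullLaw μX G θ)) :
    ∫ d, h d ∂(M.fullLaw μX G θ) = ∫ o, ∫ u, M.density θ ((o.1, u), o.2) • h ((o.1, u), o.2)
        ∂(G o.1) ∂(μX.prod M.baseZY) := by
  rw [M.integral_fullLaw, ← (M.measurePreserving_separateLatent μX G).symm.integral_comp
    (separateLatent p).symm.measurableEmbedding]
  exact Measure.integral_compProd (M.integrable_fullLaw_iff_separate.1 hh)

/-- The order of integration suited to conditioning on (X, U), as opposed to conditioning on the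
observed data. -/
lemma integral_fullLaw_condition {θ : Param p} {h : FullData p → V}
    (hh : Integrable h (M.fullLaw μX G θ)) :
    ∫ d, h d ∂(M.fullLaw μX G θ) = ∫ xu, ∫ zy, M.density θ (xu, zy) • h (xu, zy)
        ∂M.baseZY ∂(μX ⊗ₘ G) := by
  rw [M.integral_fullLaw]
  exact integral_prod _ (M.integrable_fullLaw_iff.1 hh)

lemma integrable_integral_compProd {α β : Type*} [MeasurableSpace α]
    [MeasurableSpace β] {μ : Measure α} [SFinite μ] {κ : Kernel α β} [IsSFiniteKernel κ]
    {f : α × β → V} (hf : Integrable f (μ ⊗ₘ κ)) :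
    Integrable (fun x => ∫ y, f (x, y) ∂κ x) μ :=
  Integrable.integral_compProd (κ := Kernel.const Unit μ) (η := Kernel.prodMkLeft Unit κ)
    (a := ()) hf

end

end Model

/-! ### Bayes' formula, and conditional means given (X, U) -/

namespace Model

variable {p : ℕ} (M : Model) {μX : Measure (Cov p)} [IsProbabilityMeasure μX]
  {G : Kernel (Cov p) ℝ} [IsMarkovKernel G] {θ : Param p}

lemma sigmaObs_le : sigmaObs p ≤ (inferInstance : MeasurableSpace (FullData p)) :=
  measurable_obs.comap_le

lemma sigmaX_le : sigmaX p ≤ (inferInstance : MeasurableSpace (FullData p)) :=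
  (by fun_prop : Measurable fun d : FullData p => d.1.1).comap_le

/-- The observed data likelihood is finite and positive. -/
lemma ae_integrable_density [IsFiniteMeasure (M.fullLaw μX G θ)] :
    ∀ᵐ o ∂(μX.prod M.baseZY), Integrable (fun u => M.density θ ((o.1, u), o.2)) (G o.1) ∧
      0 < ∫ u, M.density θ ((o.1, u), o.2) ∂(G o.1) := by
  have h1 := M.integrable_fullLaw_iff_separate.1
    (integrable_const (1 : ℝ) : Integrable _ (M.fullLaw μX G θ))
  simp only [smul_eq_mul, mul_one] at h1
  filter_upwards [((Measure.integrable_compProd_iff h1.aestronglyMeasurable).1 h1).1] with o ho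
  have ho' : Integrable (fun u => M.density θ ((o.1, u), o.2)) (G o.1) := ho
  refine ⟨ho', ?_⟩
  rw [integral_pos_iff_support_of_nonneg (fun u => (M.density_pos θ _).le) ho']
  have : Function.support (fun u => M.density θ ((o.1, u), o.2)) = Set.univ := by
    ext u
    simpa using (M.density_pos θ _).ne'
  rw [this, measure_univ]
  exact zero_lt_one

lemma ae_density_smul_condExpObs [IsFiniteMeasure (M.fullLaw μX G θ)] (h : FullData p → Param p) :
    ∀ᵐ o ∂(μX.prod M.baseZY),
      (∫ u, M.density θ ((o.1, u), o.2) ∂(G o.1)) • M.condExpObs G θ h o =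
        ∫ u, M.density θ ((o.1, u), o.2) • h ((o.1, u), o.2) ∂(G o.1) := by
  filter_upwards [M.ae_integrable_density (μX := μX) (G := G) (θ := θ)] with o ho
  rw [condExpObs, smul_inv_smul₀ ho.2.ne']

lemma integrable_numerator {h : FullData p → Param p} (hh : Integrable h (M.fullLaw μX G θ)) :
    Integrable (fun o : Obs p => ∫ u, M.density θ ((o.1, u), o.2) • h ((o.1, u), o.2) ∂(G o.1))
      (μX.prod M.baseZY) :=
  integrable_integral_compProd (M.integrable_fullLaw_iff_separate.1 hh)

lemma aestronglyMeasurable_condExpObs [IsFiniteMeasure (M.fullLaw μX G θ)]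
    {h : FullData p → Param p} (hh : Integrable h (M.fullLaw μX G θ)) :
    AEStronglyMeasurable (M.condExpObs G θ h) (μX.prod M.baseZY) := by
  have h1 := integrable_integral_compProd (M.integrable_fullLaw_iff_separate.1
    (integrable_const (1 : ℝ) : Integrable _ (M.fullLaw μX G θ)))
  simp only [smul_eq_mul, mul_one] at h1
  have h2 := (M.integrable_numerator hh).aestronglyMeasurable
  exact (AEMeasurable.inv h1.aestronglyMeasurable.aemeasurable).aestronglyMeasurable.smul h2

/-- Averaging the density times the norm of the Bayes ratio over u cancels the denominator and
leaves the norm of the numerator, which is integrable. -/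
lemma integrable_condExpObs [IsFiniteMeasure (M.fullLaw μX G θ)]
    {h : FullData p → Param p} (hh : Integrable h (M.fullLaw μX G θ)) :
    Integrable (fun d => M.condExpObs G θ h (obs d)) (M.fullLaw μX G θ) := by
  rw [M.integrable_fullLaw_iff_separate]
  have hm : AEStronglyMeasurable (fun q : Obs p × ℝ => M.density θ ((q.1.1, q.2), q.1.2) •
      M.condExpObs G θ h (obs ((q.1.1, q.2), q.1.2))) ((μX.prod M.baseZY) ⊗ₘ latentKernel G) := by
    have h1 := M.aestronglyMeasurable_condExpObs hh
    rw [← Measure.fst_compProd (μX.prod M.baseZY) (latentKernel G)] at h1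
    have h2 : Measurable fun q : Obs p × ℝ => M.density θ ((q.1.1, q.2), q.1.2) := by fun_prop
    exact h2.aestronglyMeasurable.smul (h1.comp_measurable measurable_fst)
  rw [Measure.integrable_compProd_iff hm]
  constructor
  · filter_upwards [M.ae_integrable_density (μX := μX) (G := G) (θ := θ)] with o ho
    exact ho.1.smul_const (M.condExpObs G θ h o)
  · refine (M.integrable_numerator hh).norm.congr ?_
    filter_upwards [M.ae_density_smul_condExpObs (μX := μX) (G := G) (θ := θ) h,
      M.ae_integrable_density (μX := μX) (G := G) (θ := θ)] with o ho ho'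
    rw [← ho, norm_smul, Real.norm_of_nonneg ho'.2.le, ← integral_mul_const]
    refine integral_congr_ae (ae_of_all _ fun u => ?_)
    simp only [norm_smul, Real.norm_of_nonneg (M.density_pos θ _).le]
    rfl

lemma setIntegral_fullLaw_obs {V : Type*} [NormedAddCommGroup V] [NormedSpace ℝ V]
    {h : FullData p → V} (hh : Integrable h (M.fullLaw μX G θ)) {t : Set (Obs p)}
    (ht : MeasurableSet t) :
    ∫ d in obs ⁻¹' t, h d ∂(M.fullLaw μX G θ) = ∫ o in t, ∫ u, M.density θ ((o.1, u), o.2) •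
        h ((o.1, u), o.2) ∂(G o.1) ∂(μX.prod M.baseZY) := by
  have ht' : MeasurableSet (obs ⁻¹' t : Set (FullData p)) := measurable_obs ht
  rw [← integral_indicator ht', M.integral_fullLaw_separate (hh.indicator ht'),
    ← integral_indicator ht]
  refine integral_congr_ae (ae_of_all _ fun o => ?_)
  by_cases ho : o ∈ t
  · have : ∀ u, ((o.1, u), o.2) ∈ (obs ⁻¹' t : Set (FullData p)) := fun u => ho
    simp [Set.indicator_of_mem, ho, this]
  · have : ∀ u, ((o.1, u), o.2) ∉ (obs ⁻¹' t : Set (FullData p)) := fun u => ho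
    simp [Set.indicator_of_notMem, ho, this]

/-- **Bayes' formula** gives a version of the conditional expectation given the observed data. -/
lemma condExpObs_ae_eq_condExp [IsFiniteMeasure (M.fullLaw μX G θ)]
    {h : FullData p → Param p} (hh : Integrable h (M.fullLaw μX G θ)) :
    (fun d => M.condExpObs G θ h (obs d)) =ᵐ[M.fullLaw μX G θ]
      (M.fullLaw μX G θ)[h | sigmaObs p] := by
  have hint := M.integrable_condExpObs hh
  refine ae_eq_condExp_of_forall_setIntegral_eq sigmaObs_le hh (fun _ _ _ => hint.integrableOn)
    ?_ ?_
  · rintro _ ⟨t, ht, rfl⟩ -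
    rw [M.setIntegral_fullLaw_obs hint ht, M.setIntegral_fullLaw_obs hh ht]
    refine setIntegral_congr_ae ht ?_
    filter_upwards [M.ae_density_smul_condExpObs (μX := μX) (G := G) (θ := θ) h] with o ho _
    rw [← ho, ← integral_smul_const]
    rfl
  · have hm := M.aestronglyMeasurable_condExpObs hh
    refine ⟨fun d => hm.mk _ (obs d), ?_, ?_⟩
    · exact hm.stronglyMeasurable_mk.comp_measurable (comap_measurable _)
    · exact (M.fullLaw_absolutelyContinuous μX G θ).ae_le
        ((M.measurePreserving_obs μX G).quasiMeasurePreserving.ae_eq_comp hm.ae_eq_mk)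

/-- The parameter `θ` lies almost surely in the interior of the natural parameter sets. -/
def InteriorAt (M : Model) (μX : Measure (Cov p)) (G : Kernel (Cov p) ℝ) (θ : Param p) : Prop :=
  ∀ᵐ d ∂(M.dominating μX G), M.treatmentPred θ d ∈ interior M.treatment.natDomain ∧
    M.outcomePred θ d ∈ interior M.outcome.natDomain

variable {M}

/-- The outcome predictor depends on z but not on y, and the treatment predictor on neither.
Integrating y out first, then z, each family is normalised in turn. -/
lemma InteriorAt.lintegral_density (h : M.InteriorAt μX G θ) :
    ∀ᵐ xu ∂(μX ⊗ₘ G), ∫⁻ zy, ENNReal.ofReal (M.density θ (xu, zy)) ∂M.baseZY = 1 := by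
  filter_upwards [Measure.ae_ae_of_ae_prod h] with xu hxu
  have hm : Measurable fun zy => ENNReal.ofReal (M.density θ (xu, zy)) := by fun_prop
  have : (ae M.baseZY).NeBot := ae_neBot.2 M.baseZY_ne_zero
  have : (ae M.outcome.base).NeBot := ae_neBot.2 M.outcome.base_ne_zero
  -- The base measures are nonzero, so an almost sure property holds at some point. The predictor is
  -- constant in the coordinate being integrated, so one point decides its membership in the natural
  -- domain.
  obtain ⟨zy₀, hzy₀⟩ := hxu.exists
  rw [baseZY, lintegral_prod _ hm.aemeasurable]
  have hinner : ∀ᵐ z ∂M.treatment.base,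
      ∫⁻ y, ENNReal.ofReal (M.density θ (xu, (z, y))) ∂M.outcome.base =
        ENNReal.ofReal (M.treatment.density (M.treatmentPred θ (xu, zy₀)) z) := by
    filter_upwards [Measure.ae_ae_of_ae_prod hxu] with z hz
    obtain ⟨y₀, hy₀⟩ := hz.exists
    have h1 : ∀ y, ENNReal.ofReal (M.density θ (xu, (z, y))) =
        ENNReal.ofReal (M.treatment.density (M.treatmentPred θ (xu, zy₀)) z) *
          ENNReal.ofReal (M.outcome.density (M.outcomePred θ (xu, (z, y₀))) y) := by
      intro y
      rw [← ENNReal.ofReal_mul (ExpFamily.density_pos _ _ _).le]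
      rfl
    have h2 : Measurable fun y =>
        ENNReal.ofReal (M.outcome.density (M.outcomePred θ (xu, (z, y₀))) y) := by
      unfold ExpFamily.density; fun_prop
    simp_rw [h1]
    rw [lintegral_const_mul _ h2, M.outcome.lintegral_density (interior_subset hy₀.2), mul_one]
  rw [lintegral_congr_ae hinner, M.treatment.lintegral_density (interior_subset hzy₀.1)]

lemma InteriorAt.isProbabilityMeasure (h : M.InteriorAt μX G θ) :
    IsProbabilityMeasure (M.fullLaw μX G θ) := by
  constructor
  rw [fullLaw, withDensity_apply _ MeasurableSet.univ, Measure.restrict_univ, dominating,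
    lintegral_prod _ (by fun_prop), lintegral_congr_ae h.lintegral_density]
  simp

lemma InteriorAt.measurePreserving_fst (h : M.InteriorAt μX G θ) :
    MeasurePreserving Prod.fst (M.fullLaw μX G θ) (μX ⊗ₘ G) := by
  refine ⟨measurable_fst, Measure.ext_of_lintegral _ fun f hf => ?_⟩
  have hm : Measurable fun d : FullData p => f d.1 := hf.comp measurable_fst
  rw [lintegral_map hf measurable_fst, fullLaw, lintegral_withDensity_eq_lintegral_mul _
    (by fun_prop) hm, dominating, lintegral_prod _ (by fun_prop)]
  refine lintegral_congr_ae ?_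
  filter_upwards [h.lintegral_density] with xu hxu
  simp only [Pi.mul_apply]
  rw [lintegral_mul_const _ (by fun_prop), hxu, one_mul]

/-- Conditions imposed under the working law of U pass to the true law by absolute continuity. -/
lemma InteriorAt.mono {F : Kernel (Cov p) ℝ} [IsMarkovKernel F] (hac : ∀ᵐ x ∂μX, F x ≪ G x)
    (h : M.InteriorAt μX G θ) : M.InteriorAt μX F θ := by
  have : M.dominating μX F ≪ M.dominating μX G :=
    (Measure.AbsolutelyContinuous.compProd_right hac).prod .rfl
  exact this.ae_le h

/-- A square integrable function whose conditional mean given `(X, U)` vanishes has mean zero and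
is uncorrelated with the functions of `(X, U)`. -/
lemma integral_mul_eq_zero_of_condExpXU {φ : Obs p → Param p}
    (hφ : ∀ᵐ xu ∂(μX ⊗ₘ G), M.condExpXU θ φ xu = 0)
    (hφint : Integrable (fun d => φ (obs d)) (M.fullLaw μX G θ)) {b : Cov p × ℝ → ℝ} {i : ParamIdx p}
    (hint : Integrable (fun d => φ (obs d) i * b d.1) (M.fullLaw μX G θ)) :
    ∫ d, φ (obs d) i * b d.1 ∂(M.fullLaw μX G θ) = 0 := by
  rw [M.integral_fullLaw_condition hint]
  refine integral_eq_zero_of_ae ?_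
  filter_upwards [hφ, (M.integrable_fullLaw_iff.1 hφint).prod_right_ae] with xu h1 h2
  have h3 : ∀ zy, M.density θ (xu, zy) • (φ (obs (xu, zy)) i * b xu) =
      EuclideanSpace.proj (𝕜 := ℝ) i (M.density θ (xu, zy) • φ (obs (xu, zy))) * b xu := by
    intro zy
    simp [mul_assoc]
  simp only [Pi.zero_apply]
  simp_rw [h3]
  rw [integral_mul_const, ContinuousLinearMap.integral_comp_comm _ h2]
  have h4 : ∫ zy, M.density θ (xu, zy) • φ (obs (xu, zy)) ∂M.baseZY = 0 := h1
  rw [h4, map_zero, zero_mul]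

lemma integral_eq_zero_of_condExpXU {φ : Obs p → Param p}
    (hφ : ∀ᵐ xu ∂(μX ⊗ₘ G), M.condExpXU θ φ xu = 0)
    (hφint : Integrable (fun d => φ (obs d)) (M.fullLaw μX G θ)) :
    ∫ d, φ (obs d) ∂(M.fullLaw μX G θ) = 0 := by
  rw [M.integral_fullLaw_condition hφint]
  exact integral_eq_zero_of_ae hφ

section WorkingScore

variable {a : Param p → Cov p × ℝ → Param p}

lemma aestronglyMeasurable_workingScore (hI : M.InteriorAt μX G θ)
    (hS : MemLp (M.fullScore θ) 2 (M.fullLaw μX G θ))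
    (ha : M.SolvesIntegralEquation μX G θ (a θ)) :
    AEStronglyMeasurable (M.workingScore G a θ) (μX.prod M.baseZY) := by
  have := hI.isProbabilityMeasure
  exact (M.aestronglyMeasurable_condExpObs (hS.integrable one_le_two)).sub
    (M.aestronglyMeasurable_condExpObs (ha.memLp.integrable one_le_two))

lemma integrable_workingScore (hI : M.InteriorAt μX G θ)
    (hS : MemLp (M.fullScore θ) 2 (M.fullLaw μX G θ))
    (ha : M.SolvesIntegralEquation μX G θ (a θ)) :
    Integrable (fun d => M.workingScore G a θ (obs d)) (M.fullLaw μX G θ) := by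
  have := hI.isProbabilityMeasure
  exact (M.integrable_condExpObs (hS.integrable one_le_two)).sub
    (M.integrable_condExpObs (ha.memLp.integrable one_le_two))

/-- The integral equation says that the working score has conditional mean zero given `(X, U)`. -/
lemma condExpXU_workingScore (hI : M.InteriorAt μX G θ)
    (hS : MemLp (M.fullScore θ) 2 (M.fullLaw μX G θ))
    (ha : M.SolvesIntegralEquation μX G θ (a θ)) :
    ∀ᵐ xu ∂(μX ⊗ₘ G), M.condExpXU θ (M.workingScore G a θ) xu = 0 := by
  have := hI.isProbabilityMeasure
  have h1 := M.integrable_condExpObs (hS.integrable one_le_two)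
  have h2 := M.integrable_condExpObs (ha.memLp.integrable one_le_two)
  filter_upwards [ha.equation, (M.integrable_fullLaw_iff.1 h1).prod_right_ae,
    (M.integrable_fullLaw_iff.1 h2).prod_right_ae] with xu he hi1 hi2
  rw [← sub_eq_zero] at he
  rw [← he]
  refine Eq.trans ?_ (integral_sub hi1 hi2)
  refine integral_congr_ae (ae_of_all _ fun zy => ?_)
  simp only [workingScore, smul_sub]

end WorkingScore

end Model

/-! ### Algebra of moment matrices -/

section CrossMoment

variable {p : ℕ} {T : Type*} [MeasurableSpace T] {P : Measure T} {f g f' g' : T → Param p}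

/-- `E[f gᵀ]`. -/
def crossMoment (P : Measure T) (f g : T → Param p) : Matrix (ParamIdx p) (ParamIdx p) ℝ :=
  Matrix.of fun i j => ∫ t, f t i * g t j ∂P

lemma crossMoment_self (P : Measure T) (f : T → Param p) : crossMoment P f f = secondMoment P f :=
  rfl

lemma crossMoment_congr (hf : f =ᵐ[P] f') (hg : g =ᵐ[P] g') :
    crossMoment P f g = crossMoment P f' g' := by
  ext i j
  refine integral_congr_ae ?_
  filter_upwards [hf, hg] with t h1 h2
  simp only [h1, h2]

lemma secondMoment_congr (hf : f =ᵐ[P] f') : secondMoment P f = secondMoment P f' :=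
  crossMoment_congr hf hf

lemma crossMoment_transpose (P : Measure T) (f g : T → Param p) :
    (crossMoment P f g).transpose = crossMoment P g f := by
  ext i j
  simp [crossMoment, mul_comm]

lemma secondMoment_transpose (P : Measure T) (f : T → Param p) :
    (secondMoment P f).transpose = secondMoment P f :=
  crossMoment_transpose P f f

lemma crossMoment_sub_left (hf : MemLp f 2 P) (hf' : MemLp f' 2 P) (hg : MemLp g 2 P) :
    crossMoment P (fun t => f t - f' t) g = crossMoment P f g - crossMoment P f' g := by
  ext i j
  simp only [crossMoment, Matrix.of_apply, Matrix.sub_apply, PiLp.sub_apply, sub_mul]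
  exact integral_sub (integrable_coord_mul_coord hf hg i j) (integrable_coord_mul_coord hf' hg i j)

lemma crossMoment_sub_right (hf : MemLp f 2 P) (hg : MemLp g 2 P) (hg' : MemLp g' 2 P) :
    crossMoment P f (fun t => g t - g' t) = crossMoment P f g - crossMoment P f g' := by
  rw [← crossMoment_transpose, crossMoment_sub_left hg hg' hf, Matrix.transpose_sub,
    crossMoment_transpose, crossMoment_transpose]

lemma crossMoment_mulVec_left (hf : MemLp f 2 P) (hg : MemLp g 2 P)
    (C : Matrix (ParamIdx p) (ParamIdx p) ℝ) :
    crossMoment P (fun t => Matrix.toEuclideanCLM (𝕜 := ℝ) C (f t)) g = C * crossMoment P f g := by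
  ext i j
  simp only [crossMoment, Matrix.of_apply, Matrix.mul_apply, Matrix.ofLp_toEuclideanCLM,
    Matrix.mulVec, dotProduct, Finset.sum_mul, mul_assoc]
  rw [integral_finsetSum _ fun k _ => (integrable_coord_mul_coord hf hg k j).const_mul _]
  simp_rw [integral_const_mul]

lemma crossMoment_mulVec_right (hf : MemLp f 2 P) (hg : MemLp g 2 P)
    (C : Matrix (ParamIdx p) (ParamIdx p) ℝ) :
    crossMoment P f (fun t => Matrix.toEuclideanCLM (𝕜 := ℝ) C (g t)) =
      crossMoment P f g * C.transpose := by
  rw [← crossMoment_transpose, crossMoment_mulVec_left hg hf, Matrix.transpose_mul,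
    crossMoment_transpose]

lemma secondMoment_mulVec (hf : MemLp f 2 P) (C : Matrix (ParamIdx p) (ParamIdx p) ℝ) :
    secondMoment P (fun t => Matrix.toEuclideanCLM (𝕜 := ℝ) C (f t)) =
      C * secondMoment P f * C.transpose := by
  have h : MemLp (fun t => Matrix.toEuclideanCLM (𝕜 := ℝ) C (f t)) 2 P :=
    (Matrix.toEuclideanCLM (𝕜 := ℝ) C).comp_memLp' hf
  rw [← crossMoment_self, crossMoment_mulVec_right h hf, crossMoment_mulVec_left hf hf]
  rfl

/-- The mean Jacobian matrix represents the integral of the derivative. -/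
lemma toEuclideanCLM_meanJacobian {s : Param p → T → Param p} {θ₀ : Param p}
    (hs : Integrable (fun t => fderiv ℝ (fun θ => s θ t) θ₀) P) :
    Matrix.toEuclideanCLM (𝕜 := ℝ) (meanJacobian P s θ₀) =
      ∫ t, fderiv ℝ (fun θ => s θ t) θ₀ ∂P := by
  refine ContinuousLinearMap.coe_inj.1
    ((EuclideanSpace.basisFun (ParamIdx p) ℝ).toBasis.ext fun j => ?_)
  ext i
  have h : Integrable (fun t => fderiv ℝ (fun θ => s θ t) θ₀ (EuclideanSpace.single j (1 : ℝ))) P :=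
    hs.apply_continuousLinearMap _
  have h2 := (EuclideanSpace.proj i : Param p →L[ℝ] ℝ).integral_comp_comm h
  simp only [OrthonormalBasis.coe_toBasis, EuclideanSpace.basisFun_apply,
    ContinuousLinearMap.coe_coe]
  rw [ContinuousLinearMap.integral_apply hs]
  refine Eq.trans ?_ h2
  simp [meanJacobian]

end CrossMoment

/-! ### Asymptotics of the working estimator -/

namespace Model

variable {p : ℕ} {M : Model}

/-- The estimator solving the working score equation is consistent and asymptotically normal, with
the sandwich covariance, even if the working model is incorrect. -/
theorem workingScore_asymptotics
    {μX : Measure (Cov p)} [IsProbabilityMeasure μX]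
    {F : Kernel (Cov p) ℝ} [IsMarkovKernel F] {θ₀ : Param p}
    {Fstar : Kernel (Cov p) ℝ} [IsMarkovKernel Fstar]
    (hac : ∀ᵐ x ∂μX, F x ≪ Fstar x)
    {Ω : Type*} [MeasurableSpace Ω] {Pr : Measure Ω} [IsProbabilityMeasure Pr]
    {O : ℕ → Ω → Obs p} (hindep : iIndepFun O Pr)
    (hlaw : ∀ i, HasLaw (O i) (M.obsLaw μX F θ₀) Pr)
    {N : Set (Param p)} (hN : IsOpen N) (hθ₀ : θ₀ ∈ N)
    (hdom : ∀ θ ∈ N, M.InteriorAt μX Fstar θ)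
    (hscore : ∀ θ ∈ N, MemLp (M.fullScore θ) 2 (M.fullLaw μX Fstar θ))
    {a : Param p → Cov p × ℝ → Param p}
    (ha : ∀ θ ∈ N, M.SolvesIntegralEquation μX Fstar θ (a θ))
    (hsq : MemLp (M.workingScore Fstar a θ₀) 2 (M.obsLaw μX F θ₀))
    (hC1 : ∀ᵐ o ∂(M.obsLaw μX F θ₀), ContDiffOn ℝ 1 (fun θ => M.workingScore Fstar a θ o) N)
    (hJint : ∀ θ ∈ N, Integrable
      (fun o => fderiv ℝ (fun ϑ => M.workingScore Fstar a ϑ o) θ) (M.obsLaw μX F θ₀))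
    (hJunif : ∀ ε : ℝ, 0 < ε → Tendsto (fun n : ℕ => Pr {ω | ∃ θ ∈ N,
      ε ≤ ‖(n : ℝ)⁻¹ • ∑ i ∈ Finset.range n,
            fderiv ℝ (fun ϑ => M.workingScore Fstar a ϑ (O i ω)) θ
          - ∫ o, fderiv ℝ (fun ϑ => M.workingScore Fstar a ϑ o) θ ∂(M.obsLaw μX F θ₀)‖})
      atTop (𝓝 0))
    (hJinv : IsUnit (meanJacobian (M.obsLaw μX F θ₀) (M.workingScore Fstar a) θ₀).det) :
    ∃ N₀ : Set (Param p), IsOpen N₀ ∧ θ₀ ∈ N₀ ∧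
      Tendsto (fun n : ℕ => Pr {ω | ¬ ∃! θ, θ ∈ N₀ ∧
        ∑ i ∈ Finset.range n, M.workingScore Fstar a θ (O i ω) = 0}) atTop (𝓝 0) ∧
      (∃ est : (n : ℕ) → (Fin n → Obs p) → Param p, (∀ n, Measurable (est n)) ∧
        Tendsto (fun n : ℕ => Pr {ω | ¬ (est n (fun i => O i ω) ∈ N₀ ∧
          ∑ i ∈ Finset.range n,
            M.workingScore Fstar a (est n (fun i => O i ω)) (O i ω) = 0)}) atTop (𝓝 0)) ∧
      ∀ θhat : ℕ → Ω → Param p, (∀ n, AEMeasurable (θhat n) Pr) →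
        Tendsto (fun n : ℕ => Pr {ω | ¬ (θhat n ω ∈ N₀ ∧
          ∑ i ∈ Finset.range n, M.workingScore Fstar a (θhat n ω) (O i ω) = 0)})
          atTop (𝓝 0) →
        TendstoInMeasure Pr θhat atTop (fun _ => θ₀) ∧
        TendstoInDistribution (fun (n : ℕ) ω => √(n : ℝ) • (θhat n ω - θ₀)) atTop id
          (fun _ => Pr)
          (multivariateGaussian 0
            (sandwich (M.obsLaw μX F θ₀) (M.workingScore Fstar a) θ₀)) := by
  set P := M.obsLaw μX F θ₀ with hP
  set s := M.workingScore Fstar a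
  have : IsProbabilityMeasure P := by
    rw [← (hlaw 0).map_eq]; exact Measure.isProbabilityMeasure_map (hlaw 0).aemeasurable
  have hmeas : ∀ θ ∈ N, AEMeasurable (s θ) P := fun θ hθ =>
    ((aestronglyMeasurable_workingScore (hdom θ hθ) (hscore θ hθ) (ha θ hθ)).mono_ac
      (M.obsLaw_absolutelyContinuous μX F θ₀)).aemeasurable
  -- The robustness to misspecification: `condExpXU` involves no law of U, so the identity known for
  -- almost every (x, u) under `Fstar` also holds under `F`, and integrating it gives unbiasedness.
  have hmean : ∫ o, s θ₀ o ∂P = 0 := by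
    rw [hP, obsLaw, integral_map measurable_obs.aemeasurable hsq.aestronglyMeasurable]
    refine integral_eq_zero_of_condExpXU ?_ ?_
    · exact (Measure.AbsolutelyContinuous.compProd_right hac).ae_le
        (condExpXU_workingScore (hdom θ₀ hθ₀) (hscore θ₀ hθ₀) (ha θ₀ hθ₀))
    · exact (hsq.integrable one_le_two).comp_measurable measurable_obs
  set J := meanJacobian P s θ₀
  have hJ := toEuclideanCLM_meanJacobian (hJint θ₀ hθ₀)
  -- The sandwich is the second moment of `J⁻¹ s`, the form in which the covariance comes out of the
  -- general theorem.
  have hsand : sandwich P s θ₀ = Matrix.of fun i j =>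
      ∫ o, (Matrix.toEuclideanCLM (𝕜 := ℝ) J⁻¹ (s θ₀ o)) i *
        (Matrix.toEuclideanCLM (𝕜 := ℝ) J⁻¹ (s θ₀ o)) j ∂P := by
    have := secondMoment_mulVec hsq J⁻¹
    rw [Matrix.transpose_nonsing_inv] at this
    exact this.symm
  rw [hsand]
  refine estimatingEquation_asymptotics hindep hlaw hN hθ₀ hmeas hsq hmean hC1 hJunif
    (B := Matrix.toEuclideanCLM (𝕜 := ℝ) J⁻¹) ?_ ?_
  · intro x
    rw [← hJ, ← mul_apply_eq_comp, ← map_mul, Matrix.mul_nonsing_inv _ hJinv, map_one]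
    rfl
  · intro x
    rw [← hJ, ← mul_apply_eq_comp, ← map_mul, Matrix.nonsing_inv_mul _ hJinv, map_one]
    rfl

end Model

/-! ### Orthogonality to the nuisance tangent space -/

namespace Model

variable {p : ℕ} {M : Model}

section Orthogonality

lemma aestronglyMeasurable_sigmaObs {P : Measure (FullData p)} {φ : Obs p → Param p}
    (hφ : AEStronglyMeasurable φ (P.map obs)) :
    AEStronglyMeasurable[sigmaObs p] (fun d => φ (obs d)) P :=
  ⟨fun d => hφ.mk _ (obs d), hφ.stronglyMeasurable_mk.comp_measurable (comap_measurable _),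
    ae_of_ae_map measurable_obs.aemeasurable hφ.ae_eq_mk⟩

/-- Conditional expectation given the observed data does not change the cross moments with
functions of the observed data. -/
lemma crossMoment_condExp {P : Measure (FullData p)} [IsFiniteMeasure P] {φ : Obs p → Param p}
    (hφ : AEStronglyMeasurable φ (P.map obs)) (hφ2 : MemLp (fun d => φ (obs d)) 2 P)
    {h : FullData p → Param p} (hh : MemLp h 2 P) :
    crossMoment P (fun d => φ (obs d)) (P[h | sigmaObs p]) =
      crossMoment P (fun d => φ (obs d)) h := by
  ext i j
  simp only [crossMoment, Matrix.of_apply]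
  have hi : AEStronglyMeasurable[sigmaObs p] (fun d => φ (obs d) i) P :=
    (EuclideanSpace.proj i : Param p →L[ℝ] ℝ).continuous.comp_aestronglyMeasurable
      (aestronglyMeasurable_sigmaObs hφ)
  have hhj : Integrable (fun d => h d j) P :=
    (EuclideanSpace.proj j : Param p →L[ℝ] ℝ).integrable_comp (hh.integrable one_le_two)
  have h1 : (fun d => (P[h | sigmaObs p] d) j) =ᵐ[P] P[fun d => h d j | sigmaObs p] :=
    ContinuousLinearMap.comp_condExp_comm (hh.integrable one_le_two)
      (EuclideanSpace.proj j : Param p →L[ℝ] ℝ)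
  have h2 := condExp_mul_of_aestronglyMeasurable_left hi
    (integrable_coord_mul_coord hφ2 hh i j) hhj
  calc ∫ d, φ (obs d) i * (P[h | sigmaObs p] d) j ∂P
      = ∫ d, (P[fun d => φ (obs d) i * h d j | sigmaObs p]) d ∂P := by
        refine integral_congr_ae ?_
        filter_upwards [h1, h2] with d hd1 hd2
        rw [hd1]
        exact hd2.symm
    _ = _ := integral_condExp sigmaObs_le

variable {μX : Measure (Cov p)} [IsProbabilityMeasure μX] {G : Kernel (Cov p) ℝ}
  [IsMarkovKernel G] {θ : Param p}

/-- Since φ depends on the observed data only, the conditional expectation of `b` may be replaced by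
`b` itself; conditioning on (X, U) then annihilates φ. -/
lemma crossMoment_eq_zero_of_condExpXU {φ : Obs p → Param p}
    [IsFiniteMeasure (M.fullLaw μX G θ)]
    (hφ0 : ∀ᵐ xu ∂(μX ⊗ₘ G), M.condExpXU θ φ xu = 0)
    (hφ : AEStronglyMeasurable φ (M.obsLaw μX G θ))
    (hφ2 : MemLp (fun d => φ (obs d)) 2 (M.fullLaw μX G θ))
    {b : Cov p × ℝ → Param p} (hb : MemLp (fun d : FullData p => b d.1) 2 (M.fullLaw μX G θ)) :
    crossMoment (M.fullLaw μX G θ) (fun d => φ (obs d))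
      ((M.fullLaw μX G θ)[fun d => b d.1 | sigmaObs p]) = 0 := by
  rw [crossMoment_condExp hφ hφ2 hb]
  ext i j
  exact integral_mul_eq_zero_of_condExpXU hφ0 (hφ2.integrable one_le_two)
    (b := fun xu => b xu j) (integrable_coord_mul_coord hφ2 hb i j)

lemma integral_inner_eq_trace {T : Type*} [MeasurableSpace T] {P : Measure T} {f g : T → Param p}
    (hf : MemLp f 2 P) (hg : MemLp g 2 P) :
    ∫ t, inner ℝ (f t) (g t) ∂P = (crossMoment P f g).trace := by
  simp only [PiLp.inner_apply, Matrix.trace, crossMoment, Matrix.diag_apply, Matrix.of_apply,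
    RCLike.inner_apply, conj_trivial]
  rw [integral_finsetSum _ fun i _ => by
    simpa only [mul_comm] using integrable_coord_mul_coord hf hg i i]
  simp only [mul_comm]

/-- Functions of the observed data with conditional mean zero given `(X, U)` are orthogonal to the
nuisance tangent space. -/
lemma toLp_mem_nuisanceTangentSpace_orthogonal {φ : Obs p → Param p}
    [IsFiniteMeasure (M.fullLaw μX G θ)]
    (hφ0 : ∀ᵐ xu ∂(μX ⊗ₘ G), M.condExpXU θ φ xu = 0)
    (hφ : AEStronglyMeasurable φ (M.obsLaw μX G θ))
    (hφ2 : MemLp (fun d => φ (obs d)) 2 (M.fullLaw μX G θ)) :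
    hφ2.toLp _ ∈ (nuisanceTangentSpace (M.fullLaw μX G θ))ᗮ := by
  set P := M.fullLaw μX G θ
  have key : ∀ b : Cov p × ℝ → Param p, MemLp (fun d : FullData p => b d.1) 2 P →
      ∀ g : Lp (Param p) 2 P, g =ᵐ[P] P[fun d => b d.1 | sigmaObs p] →
      g ∈ (ℝ ∙ hφ2.toLp _)ᗮ := by
    intro b hb g hg
    rw [Submodule.mem_orthogonal_singleton_iff_inner_right, L2.inner_def]
    have h1 : ∫ d, inner ℝ (hφ2.toLp _ d) (g d) ∂P =
        ∫ d, inner ℝ (φ (obs d)) ((P[fun d => b d.1 | sigmaObs p]) d) ∂P := by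
      refine integral_congr_ae ?_
      filter_upwards [hφ2.coeFn_toLp, hg] with d hd1 hd2
      rw [hd1, hd2]
    rw [h1, integral_inner_eq_trace hφ2 (MemLp.condExp one_le_two hb),
      crossMoment_eq_zero_of_condExpXU hφ0 hφ hφ2 hb, Matrix.trace_zero]
  -- The orthogonal complement of the line through φ is a closed subspace, so checking generators
  -- suffices. Both kinds are conditional expectations of functions of (X, U), and their centring
  -- plays no role here.
  have hle : nuisanceTangentSpace P ≤ (ℝ ∙ hφ2.toLp _)ᗮ := by
    refine Submodule.topologicalClosure_minimal _ (sup_le ?_ ?_) (Submodule.isClosed_orthogonal _)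
    · refine Submodule.span_le.2 ?_
      rintro g ⟨h, ⟨⟨a, -, rfl⟩, h2, -⟩, hg⟩
      exact key (fun xu => a xu.1) h2 g hg
    · refine Submodule.span_le.2 ?_
      rintro g ⟨h, ⟨⟨a, -, rfl⟩, h2, -⟩, hg⟩
      exact key a h2 g hg
  rw [Submodule.mem_orthogonal]
  intro g hg
  rw [real_inner_comm]
  exact Submodule.mem_orthogonal_singleton_iff_inner_right.1 (hle hg)

/-- A square integrable `a(U, X)` with conditional mean zero given `X`, in the sense of Bayes'
formula, is a full data nuisance tangent. -/
lemma mem_fullNuisance₂ (hI : M.InteriorAt μX G θ) {a : Cov p × ℝ → Param p} (ham : Measurable a)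
    (ha2 : MemLp (fun d : FullData p => a d.1) 2 (M.fullLaw μX G θ))
    (ha0 : ∀ᵐ x ∂μX, ∫ u, a (x, u) ∂(G x) = 0) :
    (fun d : FullData p => a d.1) ∈ fullNuisance₂ (M.fullLaw μX G θ) := by
  have := hI.isProbabilityMeasure
  have hint := ha2.integrable one_le_two
  have hint' : Integrable a (μX ⊗ₘ G) := by
    rw [← hI.measurePreserving_fst.map_eq, integrable_map_measure
      ham.aestronglyMeasurable measurable_fst.aemeasurable]
    exact hint
  refine ⟨⟨a, ham, rfl⟩, ha2, ?_⟩
  refine (ae_eq_condExp_of_forall_setIntegral_eq sigmaX_le hint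
    (fun _ _ _ => (integrable_zero _ _ _).integrableOn) ?_
    (aestronglyMeasurable_zero)).symm
  rintro _ ⟨t, ht, rfl⟩ -
  have hset : MeasurableSet (t ×ˢ (Set.univ : Set ℝ)) := ht.prod MeasurableSet.univ
  have hpre : (fun d : FullData p => d.1.1) ⁻¹' t = Prod.fst ⁻¹' (t ×ˢ (Set.univ : Set ℝ)) := by
    ext d; simp
  have h1 : ∫ d in Prod.fst ⁻¹' (t ×ˢ (Set.univ : Set ℝ)), a d.1 ∂(M.fullLaw μX G θ) =
      ∫ xu in t ×ˢ (Set.univ : Set ℝ), a xu ∂(μX ⊗ₘ G) := by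
    rw [← hI.measurePreserving_fst.map_eq, setIntegral_map hset ham.aestronglyMeasurable
      measurable_fst.aemeasurable]
  rw [hpre, h1, Measure.setIntegral_compProd ht MeasurableSet.univ hint'.integrableOn]
  simp only [Pi.zero_apply, integral_zero, Measure.restrict_univ]
  exact (integral_eq_zero_of_ae (ae_restrict_of_ae ha0)).symm

lemma mem_nuisanceTangentSpace_of_fullNuisance₂ {P : Measure (FullData p)}
    {h : FullData p → Param p} (hh : h ∈ fullNuisance₂ P) :
    (MemLp.condExp (m := sigmaObs p) one_le_two hh.2.1).toLp _ ∈ nuisanceTangentSpace P :=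
  Submodule.le_topologicalClosure _ (Submodule.mem_sup_right
    (Submodule.subset_span ⟨h, hh, MemLp.coeFn_toLp _⟩))

/-- Influence functions are componentwise uncorrelated with the nuisance tangents. -/
lemma crossMoment_eq_zero_of_orthogonal {P : Measure (FullData p)} [IsFiniteMeasure P]
    {φ : FullData p → Param p}
    (hφ : ∀ g ∈ nuisanceTangentSpace P, ∫ d, inner ℝ (φ d) (g d) ∂P = 0)
    {h : FullData p → Param p} (hh : h ∈ fullNuisance₂ P) :
    crossMoment P φ (P[h | sigmaObs p]) = 0 := by
  ext i j
  -- The scalar orthogonality only gives the trace of the cross moment. The tangent space is stable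
  -- under linear maps of the values, and moving coordinate `j` into slot `i` isolates the entry
  -- `(i, j)`.
  let L : Param p →L[ℝ] Param p :=
    (EuclideanSpace.proj j : Param p →L[ℝ] ℝ).smulRight (EuclideanSpace.single i (1 : ℝ))
  have hhint := hh.2.1.integrable one_le_two
  have hL : (fun d => L (h d)) ∈ fullNuisance₂ P := by
    obtain ⟨⟨a, ham, rfl⟩, h2, h0⟩ := hh
    refine ⟨⟨fun xu => L (a xu), L.continuous.measurable.comp ham, rfl⟩, L.comp_memLp' h2, ?_⟩
    refine (ContinuousLinearMap.comp_condExp_comm hhint L).symm.trans ?_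
    filter_upwards [h0] with d hd
    simp [hd]
  have h1 := hφ _ (mem_nuisanceTangentSpace_of_fullNuisance₂ hL)
  have h2 := ContinuousLinearMap.comp_condExp_comm (m := sigmaObs p) hhint L
  rw [Matrix.zero_apply, ← h1]
  refine integral_congr_ae ?_
  filter_upwards [h2, (MemLp.condExp (m := sigmaObs p) one_le_two hL.2.1).coeFn_toLp] with d hd1 hd2
  have hd1' : L ((P[h | sigmaObs p]) d) = (P[fun d => L (h d) | sigmaObs p]) d := hd1
  rw [hd2, ← hd1']
  simp [L, inner_smul_right, EuclideanSpace.inner_single_right, mul_comm]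

end Orthogonality

end Model

/-! ### The information identity for the working score -/

namespace Model

variable {p : ℕ} {M : Model} {μX : Measure (Cov p)} [IsProbabilityMeasure μX]
  {G : Kernel (Cov p) ℝ} [IsMarkovKernel G]

lemma differentiableAt_density {θ : Param p} {d : FullData p}
    (h1 : M.treatmentPred θ d ∈ interior M.treatment.natDomain)
    (h2 : M.outcomePred θ d ∈ interior M.outcome.natDomain) :
    DifferentiableAt ℝ (fun ϑ => M.density ϑ d) θ := by
  have ht : DifferentiableAt ℝ (fun ϑ => M.treatmentPred ϑ d) θ := by
    unfold treatmentPred; fun_prop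
  have ho : DifferentiableAt ℝ (fun ϑ => M.outcomePred ϑ d) θ := by
    unfold outcomePred; fun_prop
  have hct : DifferentiableAt ℝ (fun ϑ => M.treatment.cumulant (M.treatmentPred ϑ d)) θ :=
    (M.treatment.differentiableAt_cumulant h1).fun_comp' θ ht
  have hco : DifferentiableAt ℝ (fun ϑ => M.outcome.cumulant (M.outcomePred ϑ d)) θ :=
    (M.outcome.differentiableAt_cumulant h2).fun_comp' θ ho
  unfold density ExpFamily.density
  fun_prop

/-- The derivative of the likelihood is the likelihood times the score. -/
lemma fderiv_density {θ : Param p} {d : FullData p}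
    (h : DifferentiableAt ℝ (fun ϑ => M.density ϑ d) θ) :
    fderiv ℝ (fun ϑ => M.density ϑ d) θ = M.density θ d • innerSL ℝ (M.fullScore θ d) := by
  have hne := (M.density_pos θ d).ne'
  ext v
  have h1 : inner ℝ (M.fullScore θ d) v = fderiv ℝ (fun ϑ => Real.log (M.density ϑ d)) θ v := by
    rw [fullScore, gradient, InnerProductSpace.toDual_symm_apply]
  rw [smul_apply, innerSL_apply_apply, h1, fderiv.log h hne]
  simp [hne]

lemma aestronglyMeasurable_smulRight {T V : Type*} [MeasurableSpace T] {P : Measure T}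
    [NormedAddCommGroup V] [InnerProductSpace ℝ V] {f g : T → V}
    (hf : AEStronglyMeasurable f P) (hg : AEStronglyMeasurable g P) :
    AEStronglyMeasurable (fun t => (innerSL ℝ (f t)).smulRight (g t)) P := by
  have hc : Continuous fun q : V × V => (innerSL ℝ q.1).smulRight q.2 :=
    (ContinuousLinearMap.smulRightL ℝ V V).continuous₂.comp
      (((innerSL ℝ).continuous.comp continuous_fst).prodMk continuous_snd)
  exact hc.comp_aestronglyMeasurable (hf.prodMk hg)

/-- Differentiation of the identity `E_θ[S⁎_eff(O; θ)] = 0`, when the working model is correct. -/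
lemma meanJacobian_workingScore {θ₀ : Param p} {N : Set (Param p)} (hN : IsOpen N) (hθ₀ : θ₀ ∈ N)
    (hdom : ∀ᵐ d ∂(M.dominating μX G), ∀ θ ∈ N,
      M.treatmentPred θ d ∈ interior M.treatment.natDomain ∧
      M.outcomePred θ d ∈ interior M.outcome.natDomain)
    (hscore : ∀ θ ∈ N, MemLp (M.fullScore θ) 2 (M.fullLaw μX G θ))
    {a : Param p → Cov p × ℝ → Param p}
    (ha : ∀ θ ∈ N, M.SolvesIntegralEquation μX G θ (a θ))
    (hsq : MemLp (fun d => M.workingScore G a θ₀ (obs d)) 2 (M.fullLaw μX G θ₀))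
    (hC1 : ∀ᵐ o ∂(M.obsLaw μX G θ₀), ContDiffOn ℝ 1 (fun θ => M.workingScore G a θ o) N)
    (hJint : Integrable
      (fun o => fderiv ℝ (fun ϑ => M.workingScore G a ϑ o) θ₀) (M.obsLaw μX G θ₀))
    {g : FullData p → ℝ} (hg : Integrable g (M.dominating μX G))
    (hbound : ∀ᵐ d ∂(M.dominating μX G), ∀ θ ∈ N,
      ‖fderiv ℝ (fun ϑ => M.density ϑ d • M.workingScore G a ϑ (obs d)) θ‖ ≤ g d) :
    meanJacobian (M.obsLaw μX G θ₀) (M.workingScore G a) θ₀ =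
      -crossMoment (M.fullLaw μX G θ₀) (fun d => M.workingScore G a θ₀ (obs d))
        (M.fullScore θ₀) := by
  have hIN : ∀ θ ∈ N, M.InteriorAt μX G θ := fun θ hθ => by
    filter_upwards [hdom] with d hd using hd θ hθ
  set P := M.fullLaw μX G θ₀ with hP
  have hdP : M.dominating μX G ≪ P := M.dominating_absolutelyContinuous μX G θ₀
  have hC1' : ∀ᵐ d ∂(M.dominating μX G),
      ContDiffOn ℝ 1 (fun θ => M.workingScore G a θ (obs d)) N :=
    hdP.ae_le (ae_of_ae_map measurable_obs.aemeasurable hC1)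
  have hws : ∀ᵐ d ∂(M.dominating μX G), ∀ θ ∈ N,
      DifferentiableAt ℝ (fun ϑ => M.workingScore G a ϑ (obs d)) θ := by
    filter_upwards [hC1'] with d hd θ hθ
    exact (hd.contDiffAt (hN.mem_nhds hθ)).differentiableAt one_ne_zero
  have hdens : ∀ᵐ d ∂(M.dominating μX G), ∀ θ ∈ N,
      DifferentiableAt ℝ (fun ϑ => M.density ϑ d) θ := by
    filter_upwards [hdom] with d hd θ hθ
    exact differentiableAt_density (hd θ hθ).1 (hd θ hθ).2
  have hint : ∀ θ ∈ N, Integrable (fun d => M.density θ d • M.workingScore G a θ (obs d))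
      (M.dominating μX G) := fun θ hθ =>
    M.integrable_fullLaw_iff.1 (integrable_workingScore (hIN θ hθ) (hscore θ hθ) (ha θ hθ))
  have hzero : ∀ θ ∈ N, ∫ d, M.density θ d • M.workingScore G a θ (obs d)
      ∂(M.dominating μX G) = 0 := fun θ hθ => by
    rw [← M.integral_fullLaw]
    exact integral_eq_zero_of_condExpXU
      (condExpXU_workingScore (hIN θ hθ) (hscore θ hθ) (ha θ hθ))
      (integrable_workingScore (hIN θ hθ) (hscore θ hθ) (ha θ hθ))
  -- The product rule, with the derivative of the density written as density times score: this
  -- produces the Jacobian term and the cross moment term.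
  have hfd : ∀ᵐ d ∂(M.dominating μX G),
      fderiv ℝ (fun ϑ => M.density ϑ d • M.workingScore G a ϑ (obs d)) θ₀ =
        M.density θ₀ d • (fderiv ℝ (fun ϑ => M.workingScore G a ϑ (obs d)) θ₀ +
          (innerSL ℝ (M.fullScore θ₀ d)).smulRight (M.workingScore G a θ₀ (obs d))) := by
    filter_upwards [hws, hdens] with d h1 h2
    rw [fderiv_fun_smul (h2 θ₀ hθ₀) (h1 θ₀ hθ₀), fderiv_density (h2 θ₀ hθ₀), smul_add]
    congr 1
    ext v
    simp [mul_smul]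
  have hJ' : Integrable (fun d => fderiv ℝ (fun ϑ => M.workingScore G a ϑ (obs d)) θ₀) P :=
    hJint.comp_measurable measurable_obs
  have hmeasP : AEStronglyMeasurable (fun d =>
      fderiv ℝ (fun ϑ => M.workingScore G a ϑ (obs d)) θ₀ +
        (innerSL ℝ (M.fullScore θ₀ d)).smulRight (M.workingScore G a θ₀ (obs d))) P := by
    refine hJ'.aestronglyMeasurable.add ?_
    exact aestronglyMeasurable_smulRight (hscore θ₀ hθ₀).aestronglyMeasurable
      hsq.aestronglyMeasurable
  -- Measurability in the data of a derivative in θ is not automatic; it is read off from the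
  -- product rule.
  have hmeas : AEStronglyMeasurable (fun d =>
      fderiv ℝ (fun ϑ => M.density ϑ d • M.workingScore G a ϑ (obs d)) θ₀) (M.dominating μX G) := by
    refine AEStronglyMeasurable.congr ?_ (EventuallyEq.symm hfd)
    exact (M.measurable_density θ₀).aestronglyMeasurable.smul (hmeasP.mono_ac hdP)
  have hderiv := hasFDerivAt_integral_of_dominated_of_fderiv_le
    (F := fun θ d => M.density θ d • M.workingScore G a θ (obs d))
    (F' := fun θ d => fderiv ℝ (fun ϑ => M.density ϑ d • M.workingScore G a ϑ (obs d)) θ)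
    (hN.mem_nhds hθ₀) (by
      filter_upwards [hN.mem_nhds hθ₀] with θ hθ using (hint θ hθ).aestronglyMeasurable)
    (hint θ₀ hθ₀) hmeas hbound hg (by
      filter_upwards [hws, hdens] with d h1 h2 θ hθ
      exact ((h2 θ hθ).fun_smul (h1 θ hθ)).hasFDerivAt)
  -- The working law at θ is here the true law at θ, so the mean of the score vanishes on all of `N`
  -- and the integral has derivative zero.
  have hconst : HasFDerivAt (fun θ => ∫ d, M.density θ d • M.workingScore G a θ (obs d)
      ∂(M.dominating μX G)) (0 : Param p →L[ℝ] Param p) θ₀ := by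
    refine (hasFDerivAt_const (0 : Param p) θ₀).congr_of_eventuallyEq ?_
    filter_upwards [hN.mem_nhds hθ₀] with θ hθ using hzero θ hθ
  have h0 := hderiv.unique hconst
  have hdint : Integrable (fun d =>
      fderiv ℝ (fun ϑ => M.density ϑ d • M.workingScore G a ϑ (obs d)) θ₀) (M.dominating μX G) :=
    hg.mono' hmeas (by filter_upwards [hbound] with d hd using hd θ₀ hθ₀)
  ext i j
  have hj := hdint.apply_continuousLinearMap (EuclideanSpace.single j (1 : ℝ))
  have h2 := (EuclideanSpace.proj i : Param p →L[ℝ] ℝ).integral_comp_comm hj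
  rw [← ContinuousLinearMap.integral_apply hdint, h0, zero_apply, map_zero] at h2
  have h3 : ∫ d, ((fderiv ℝ (fun ϑ => M.workingScore G a ϑ (obs d)) θ₀
        (EuclideanSpace.single j (1 : ℝ))) i +
      M.workingScore G a θ₀ (obs d) i * M.fullScore θ₀ d j) ∂P = 0 := by
    rw [hP, M.integral_fullLaw, ← h2]
    refine integral_congr_ae ?_
    filter_upwards [hfd] with d hd
    rw [hd]
    simp [EuclideanSpace.inner_single_right, mul_comm, mul_add]
  have hJij : Integrable (fun d => (fderiv ℝ (fun ϑ => M.workingScore G a ϑ (obs d)) θ₀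
        (EuclideanSpace.single j (1 : ℝ))) i) P :=
    (EuclideanSpace.proj i : Param p →L[ℝ] ℝ).integrable_comp
      (hJ'.apply_continuousLinearMap (EuclideanSpace.single j (1 : ℝ)))
  rw [integral_add hJij (integrable_coord_mul_coord hsq (hscore θ₀ hθ₀) i j)] at h3
  have h4 : meanJacobian (M.obsLaw μX G θ₀) (M.workingScore G a) θ₀ i j =
      ∫ d, (fderiv ℝ (fun ϑ => M.workingScore G a ϑ (obs d)) θ₀
        (EuclideanSpace.single j (1 : ℝ))) i ∂P := by
    have hm : AEStronglyMeasurable (fun o => (fderiv ℝ (fun ϑ => M.workingScore G a ϑ o) θ₀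
        (EuclideanSpace.single j (1 : ℝ))) i) (P.map obs) :=
      ((EuclideanSpace.proj i : Param p →L[ℝ] ℝ).integrable_comp
        (hJint.apply_continuousLinearMap
          (EuclideanSpace.single j (1 : ℝ)))).aestronglyMeasurable
    exact integral_map measurable_obs.aemeasurable hm
  rw [h4, Matrix.neg_apply]
  exact eq_neg_of_add_eq_zero_left h3

end Model

/-! ### Local efficiency -/

namespace Model

variable {p : ℕ} {M : Model} {μX : Measure (Cov p)} [IsProbabilityMeasure μX]
  {G : Kernel (Cov p) ℝ} [IsMarkovKernel G]

lemma workingScore_ae_eq_condExp_sub {θ : Param p} {a : Param p → Cov p × ℝ → Param p}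
    (hI : M.InteriorAt μX G θ) (hS : MemLp (M.fullScore θ) 2 (M.fullLaw μX G θ))
    (ha : M.SolvesIntegralEquation μX G θ (a θ)) :
    (fun d => M.workingScore G a θ (obs d)) =ᵐ[M.fullLaw μX G θ] fun d =>
      ((M.fullLaw μX G θ)[M.fullScore θ | sigmaObs p]) d -
        ((M.fullLaw μX G θ)[fun d => a θ d.1 | sigmaObs p]) d := by
  have := hI.isProbabilityMeasure
  filter_upwards [M.condExpObs_ae_eq_condExp (hS.integrable one_le_two),
    M.condExpObs_ae_eq_condExp (ha.memLp.integrable one_le_two)] with d h1 h2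
  rw [← h1, ← h2]
  rfl

/-- With a correct working model the working score is the efficient score. -/
lemma workingScore_ae_eq_efficientScore {θ : Param p} {a : Param p → Cov p × ℝ → Param p}
    (hI : M.InteriorAt μX G θ) (hS : MemLp (M.fullScore θ) 2 (M.fullLaw μX G θ))
    (ha : M.SolvesIntegralEquation μX G θ (a θ))
    (hm : AEStronglyMeasurable (M.workingScore G a θ) (M.obsLaw μX G θ))
    (hsq : MemLp (fun d => M.workingScore G a θ (obs d)) 2 (M.fullLaw μX G θ)) :
    (fun d => M.workingScore G a θ (obs d)) =ᵐ[M.fullLaw μX G θ]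
      efficientScore (M.fullLaw μX G θ) (M.fullScore θ) := by
  have := hI.isProbabilityMeasure
  set P := M.fullLaw μX G θ
  have hScond : MemLp (P[M.fullScore θ | sigmaObs p]) 2 P := MemLp.condExp one_le_two hS
  have hacond : MemLp (P[fun d => a θ d.1 | sigmaObs p]) 2 P := MemLp.condExp one_le_two ha.memLp
  have hperp := toLp_mem_nuisanceTangentSpace_orthogonal (condExpXU_workingScore hI hS ha) hm hsq
  have hmem := mem_nuisanceTangentSpace_of_fullNuisance₂
    (mem_fullNuisance₂ hI ha.measurable ha.memLp ha.mean_zero)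
  -- The orthogonal decomposition of the observed data score: a nuisance tangent plus the working
  -- score. It identifies the projection.
  have hsum : hScond.toLp _ = hacond.toLp _ + hsq.toLp _ := by
    rw [← MemLp.toLp_add]
    refine MemLp.toLp_congr _ _ ?_
    filter_upwards [workingScore_ae_eq_condExp_sub hI hS ha] with d hd
    simp only [Pi.add_apply, hd]
    abel
  have hproj : (nuisanceTangentSpace P).starProjection (hScond.toLp _) = hacond.toLp _ :=
    Submodule.eq_starProjection_of_mem_orthogonal' hmem hperp hsum
  have heff : efficientScore P (M.fullScore θ) = hsq.toLp _ := by
    rw [efficientScore, toL2, dif_pos hScond, hproj, hsum, add_sub_cancel_left]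
  rw [heff]
  exact hsq.coeFn_toLp.symm

/-- Local efficiency when the working model is correct. -/
theorem workingScore_efficient {θ₀ : Param p} {N : Set (Param p)} (hN : IsOpen N) (hθ₀ : θ₀ ∈ N)
    (hdom : ∀ᵐ d ∂(M.dominating μX G), ∀ θ ∈ N,
      M.treatmentPred θ d ∈ interior M.treatment.natDomain ∧
      M.outcomePred θ d ∈ interior M.outcome.natDomain)
    (hscore : ∀ θ ∈ N, MemLp (M.fullScore θ) 2 (M.fullLaw μX G θ))
    {a : Param p → Cov p × ℝ → Param p}
    (ha : ∀ θ ∈ N, M.SolvesIntegralEquation μX G θ (a θ))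
    (hsq : MemLp (M.workingScore G a θ₀) 2 (M.obsLaw μX G θ₀))
    (hC1 : ∀ᵐ o ∂(M.obsLaw μX G θ₀), ContDiffOn ℝ 1 (fun θ => M.workingScore G a θ o) N)
    (hJint : Integrable
      (fun o => fderiv ℝ (fun ϑ => M.workingScore G a ϑ o) θ₀) (M.obsLaw μX G θ₀))
    (hJinv : IsUnit (meanJacobian (M.obsLaw μX G θ₀) (M.workingScore G a) θ₀).det)
    {g : FullData p → ℝ} (hg : Integrable g (M.dominating μX G))
    (hbound : ∀ᵐ d ∂(M.dominating μX G), ∀ θ ∈ N,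
      ‖fderiv ℝ (fun ϑ => M.density ϑ d • M.workingScore G a ϑ (obs d)) θ‖ ≤ g d) :
    (fun d => M.workingScore G a θ₀ (obs d)) =ᵐ[M.fullLaw μX G θ₀]
      efficientScore (M.fullLaw μX G θ₀) (M.fullScore θ₀) ∧
    IsUnit (efficientInformation (M.fullLaw μX G θ₀) (M.fullScore θ₀)).det ∧
    efficiencyBound (M.fullLaw μX G θ₀) (M.fullScore θ₀) =
      (efficientInformation (M.fullLaw μX G θ₀) (M.fullScore θ₀))⁻¹ ∧
    sandwich (M.obsLaw μX G θ₀) (M.workingScore G a) θ₀ =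
      efficiencyBound (M.fullLaw μX G θ₀) (M.fullScore θ₀) ∧
    (∃ φ : Obs p → Param p, IsInfluenceFunction (M.fullLaw μX G θ₀) (M.fullScore θ₀) φ ∧
      (fun d => φ (obs d)) =ᵐ[M.fullLaw μX G θ₀]
        efficientInfluence (M.fullLaw μX G θ₀) (M.fullScore θ₀)) ∧
    ∀ φ : Obs p → Param p, IsInfluenceFunction (M.fullLaw μX G θ₀) (M.fullScore θ₀) φ →
      (secondMoment (M.fullLaw μX G θ₀) (fun d => φ (obs d)) -
        efficiencyBound (M.fullLaw μX G θ₀) (M.fullScore θ₀)).PosSemidef := by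
  have hI : M.InteriorAt μX G θ₀ := by filter_upwards [hdom] with d hd using hd θ₀ hθ₀
  have hS := hscore θ₀ hθ₀
  have haθ := ha θ₀ hθ₀
  have := hI.isProbabilityMeasure
  have hsq' : MemLp (fun d => M.workingScore G a θ₀ (obs d)) 2 (M.fullLaw μX G θ₀) :=
    hsq.comp_of_map measurable_obs.aemeasurable
  have heff := workingScore_ae_eq_efficientScore hI hS haθ hsq.aestronglyMeasurable hsq'
  have hJac := meanJacobian_workingScore hN hθ₀ hdom hscore ha hsq' hC1 hJint hg hbound
  have hperp := toLp_mem_nuisanceTangentSpace_orthogonal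
    (condExpXU_workingScore hI hS haθ) hsq.aestronglyMeasurable hsq'
  have hcond0 := condExpXU_workingScore hI hS haθ
  have hnuis := mem_fullNuisance₂ hI haθ.measurable haθ.memLp haθ.mean_zero
  set P := M.fullLaw μX G θ₀ with hP
  set W : FullData p → Param p := fun d => M.workingScore G a θ₀ (obs d) with hW
  set S := M.fullScore θ₀
  have hScond : MemLp (P[S | sigmaObs p]) 2 P := MemLp.condExp one_le_two hS
  have hacond : MemLp (P[fun d => a θ₀ d.1 | sigmaObs p]) 2 P :=
    MemLp.condExp one_le_two haθ.memLp
  have hWeq := workingScore_ae_eq_condExp_sub hI hS haθ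
  set B := efficientInformation P S with hB
  have hBW : B = secondMoment P W := secondMoment_congr heff.symm
  have hBt : B.transpose = B := secondMoment_transpose _ _
  -- the efficient information is the cross moment of the efficient score and the score
  have hWS : crossMoment P W S = B := by
    have h1 : crossMoment P W W = crossMoment P W (P[S | sigmaObs p]) -
        crossMoment P W (P[fun d => a θ₀ d.1 | sigmaObs p]) := by
      rw [← crossMoment_sub_right hsq' hScond hacond]
      exact crossMoment_congr EventuallyEq.rfl hWeq
    rw [crossMoment_condExp hsq.aestronglyMeasurable hsq' hS,
      crossMoment_eq_zero_of_condExpXU hcond0 hsq.aestronglyMeasurable hsq' haθ.memLp,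
      sub_zero] at h1
    rw [hBW, ← h1, crossMoment_self]
  have hJB : meanJacobian (M.obsLaw μX G θ₀) (M.workingScore G a) θ₀ = -B := by
    rw [hJac, hWS]
  -- Invertibility of the information is inherited from the Jacobian, as `det (-B) = ± det B`.
  have hBdet : IsUnit B.det := by
    rw [hJB, Matrix.det_neg] at hJinv
    exact isUnit_of_mul_isUnit_right hJinv
  have hBB : B⁻¹ * B = 1 := Matrix.nonsing_inv_mul _ hBdet
  have hBinvt : (B⁻¹).transpose = B⁻¹ := by rw [Matrix.transpose_nonsing_inv, hBt]
  set L := Matrix.toEuclideanCLM (𝕜 := ℝ) B⁻¹ with hL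
  have hinf : (fun d => L (W d)) =ᵐ[P] efficientInfluence P S := by
    filter_upwards [heff] with d hd
    ext i
    rw [hL, Matrix.ofLp_toEuclideanCLM, hd]
    rfl
  have hLW : MemLp (fun d => L (W d)) 2 P := L.comp_memLp' hsq'
  have hLWsq : secondMoment P (fun d => L (W d)) = B⁻¹ := by
    rw [secondMoment_mulVec hsq', ← hBW, hBB, one_mul, hBinvt]
  have hbd : efficiencyBound P S = B⁻¹ := by
    rw [efficiencyBound, ← secondMoment_congr hinf, hLWsq]
  have hsand : sandwich (M.obsLaw μX G θ₀) (M.workingScore G a) θ₀ = B⁻¹ := by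
    have h1 : secondMoment (M.obsLaw μX G θ₀) (M.workingScore G a θ₀) = B := by
      rw [hBW]
      ext i j
      exact integral_map measurable_obs.aemeasurable
        (integrable_coord_mul_coord hsq hsq i j).aestronglyMeasurable
    have hneg : (-B)⁻¹ = -B⁻¹ := by
      refine Matrix.inv_eq_left_inv ?_
      rw [neg_mul_neg, hBB]
    rw [sandwich, hJB, h1, Matrix.transpose_neg, hBt, hneg, neg_mul, hBB, neg_mul_neg, one_mul]
  refine ⟨heff, hBdet, hbd, hsand.trans hbd.symm, ?_, ?_⟩
  · have hm := hsq.aestronglyMeasurable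
    have hmk : (fun d => L (hm.mk _ (obs d))) =ᵐ[P] fun d => L (W d) := by
      filter_upwards [ae_of_ae_map measurable_obs.aemeasurable hm.ae_eq_mk] with d hd
      rw [← hd]
    -- An influence function must be measurable outright, whereas the working score is so only up to
    -- a null set; hence the modification.
    refine ⟨fun o => L (hm.mk _ o), ?_, hmk.trans hinf⟩
    have hLcond0 : ∀ᵐ xu ∂(μX ⊗ₘ G),
        M.condExpXU θ₀ (fun o => L (M.workingScore G a θ₀ o)) xu = 0 := by
      filter_upwards [hcond0, (M.integrable_fullLaw_iff.1
        (hsq'.integrable one_le_two)).prod_right_ae] with xu h1 h2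
      have h3 := L.integral_comp_comm h2
      unfold condExpXU at h1 ⊢
      simp only [map_smul] at h3
      refine h3.trans ?_
      rw [← map_zero L, ← h1]
      rfl
    have hLperp := toLp_mem_nuisanceTangentSpace_orthogonal hLcond0
      (L.continuous.comp_aestronglyMeasurable hm) hLW
    refine ⟨L.continuous.measurable.comp hm.stronglyMeasurable_mk.measurable,
      hLW.ae_eq hmk.symm, ?_, ?_, ?_⟩
    · rw [integral_congr_ae hmk, L.integral_comp_comm (hsq'.integrable one_le_two),
        integral_eq_zero_of_condExpXU hcond0 (hsq'.integrable one_le_two), map_zero]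
    · intro g hg
      have h1 := (Submodule.mem_orthogonal' _ _).1 hLperp g hg
      rw [L2.inner_def] at h1
      rw [← h1]
      refine integral_congr_ae ?_
      filter_upwards [hmk, hLW.coeFn_toLp] with d h2 h3
      rw [h2, h3]
    · intro i j
      have h1 : crossMoment P S (fun d => L (hm.mk _ (obs d))) = 1 := by
        rw [crossMoment_congr EventuallyEq.rfl hmk, crossMoment_mulVec_right hS hsq', hBinvt,
          ← crossMoment_transpose, hWS, hBt, Matrix.mul_nonsing_inv _ hBdet]
      exact congrFun (congrFun h1 i) j
  · intro φ hφ
    have hφm : AEStronglyMeasurable φ (P.map obs) := hφ.measurable.aestronglyMeasurable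
    set Φ : FullData p → Param p := fun d => φ (obs d)
    have hφS : crossMoment P Φ S = 1 := by
      rw [← crossMoment_transpose]
      ext i j
      rw [Matrix.transpose_apply]
      exact (hφ.normalized j i).trans (by rw [Matrix.one_apply, Matrix.one_apply]; simp [eq_comm])
    -- φ is uncorrelated with the nuisance part E[a | O], so the normalisation against the full
    -- score carries over to the efficient score.
    have hφW : crossMoment P Φ W = 1 := by
      rw [crossMoment_congr EventuallyEq.rfl hWeq, crossMoment_sub_right hφ.memLp hScond hacond,
        crossMoment_condExp hφm hφ.memLp hS, hφS,
        crossMoment_eq_zero_of_orthogonal hφ.orthogonal hnuis, sub_zero]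
    have hφLW : crossMoment P Φ (fun d => L (W d)) = B⁻¹ := by
      rw [crossMoment_mulVec_right hφ.memLp hsq', hφW, one_mul, hBinvt]
    have hLWφ : crossMoment P (fun d => L (W d)) Φ = B⁻¹ := by
      rw [← crossMoment_transpose, hφLW, hBinvt]
    have hdiff : MemLp (fun d => Φ d - L (W d)) 2 P := hφ.memLp.sub hLW
    -- Pythagoras: both cross terms and the second moment of `L W` equal `B⁻¹`, so the expansion
    -- leaves `E[φφᵀ] - B⁻¹`.
    have hkey : secondMoment P (fun d => Φ d - L (W d)) = secondMoment P Φ - efficiencyBound P S := by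
      rw [← crossMoment_self, crossMoment_sub_left hφ.memLp hLW hdiff,
        crossMoment_sub_right hφ.memLp hφ.memLp hLW, crossMoment_sub_right hLW hφ.memLp hLW,
        hφLW, hLWφ, crossMoment_self, crossMoment_self, hLWsq, hbd, sub_self, sub_zero]
    rw [← hkey]
    exact posSemidef_integral_coord hdiff

end Model

end SensitivityAnalysis

end

/-! ### The main theorem -/

open SensitivityAnalysis in
theorem mainTheorem2 {p : ℕ} (M : Model)
    -- the true law: `X ~ μX`, `U | X ~ F` arbitrary, true parameter `θ₀`
    (μX : Measure (Cov p)) [IsProbabilityMeasure μX]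
    (F : Kernel (Cov p) ℝ) [IsMarkovKernel F] (θ₀ : Param p)
    -- the possibly incorrect working model for `U | X`
    (Fstar : Kernel (Cov p) ℝ) [IsMarkovKernel Fstar]
    (hac : ∀ᵐ x ∂μX, F x ≪ Fstar x)
    -- the sample
    {Ω : Type*} [MeasurableSpace Ω] (Pr : Measure Ω) [IsProbabilityMeasure Pr]
    (O : ℕ → Ω → Obs p) (hindep : iIndepFun O Pr)
    (hlaw : ∀ i, HasLaw (O i) (M.obsLaw μX F θ₀) Pr)
    -- an open neighbourhood of `θ₀` in which the natural parameters are interior, the full data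
    -- score is square integrable under the working law, and the integral equation has a solution
    (N : Set (Param p)) (hN : IsOpen N) (hθ₀ : θ₀ ∈ N)
    (hdom : ∀ᵐ d ∂(M.dominating μX Fstar), ∀ θ ∈ N,
      M.treatmentPred θ d ∈ interior M.treatment.natDomain ∧
      M.outcomePred θ d ∈ interior M.outcome.natDomain)
    (hscore : ∀ θ ∈ N, MemLp (M.fullScore θ) 2 (M.fullLaw μX Fstar θ))
    (a : Param p → Cov p × ℝ → Param p)
    (ha : ∀ θ ∈ N, M.SolvesIntegralEquation μX Fstar θ (a θ))
    -- regularity of the estimating function under the true law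
    (hsq : MemLp (M.workingScore Fstar a θ₀) 2 (M.obsLaw μX F θ₀))
    (hC1 : ∀ᵐ o ∂(M.obsLaw μX F θ₀), ContDiffOn ℝ 1 (fun θ => M.workingScore Fstar a θ o) N)
    (hJint : ∀ θ ∈ N, Integrable
      (fun o => fderiv ℝ (fun ϑ => M.workingScore Fstar a ϑ o) θ) (M.obsLaw μX F θ₀))
    (hJunif : ∀ ε : ℝ, 0 < ε → Tendsto (fun n : ℕ => Pr {ω | ∃ θ ∈ N,
      ε ≤ ‖(n : ℝ)⁻¹ • ∑ i ∈ Finset.range n,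
            fderiv ℝ (fun ϑ => M.workingScore Fstar a ϑ (O i ω)) θ
          - ∫ o, fderiv ℝ (fun ϑ => M.workingScore Fstar a ϑ o) θ ∂(M.obsLaw μX F θ₀)‖})
      atTop (𝓝 0))
    (hJinv : IsUnit (meanJacobian (M.obsLaw μX F θ₀) (M.workingScore Fstar a) θ₀).det) :
    -- consistency and asymptotic normality
    (∃ N₀ : Set (Param p), IsOpen N₀ ∧ θ₀ ∈ N₀ ∧
      -- with probability tending to one there is exactly one root in `N₀`
      Tendsto (fun n : ℕ => Pr {ω | ¬ ∃! θ, θ ∈ N₀ ∧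
        ∑ i ∈ Finset.range n, M.workingScore Fstar a θ (O i ω) = 0}) atTop (𝓝 0) ∧
      -- it is found by a measurable function of the observed data
      (∃ est : (n : ℕ) → (Fin n → Obs p) → Param p, (∀ n, Measurable (est n)) ∧
        Tendsto (fun n : ℕ => Pr {ω | ¬ (est n (fun i => O i ω) ∈ N₀ ∧
          ∑ i ∈ Finset.range n,
            M.workingScore Fstar a (est n (fun i => O i ω)) (O i ω) = 0)}) atTop (𝓝 0)) ∧
      -- every estimator that solves the estimating equation in `N₀` is CAN
      ∀ θhat : ℕ → Ω → Param p, (∀ n, AEMeasurable (θhat n) Pr) →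
        Tendsto (fun n : ℕ => Pr {ω | ¬ (θhat n ω ∈ N₀ ∧
          ∑ i ∈ Finset.range n, M.workingScore Fstar a (θhat n ω) (O i ω) = 0)})
          atTop (𝓝 0) →
        TendstoInMeasure Pr θhat atTop (fun _ => θ₀) ∧
        TendstoInDistribution (fun (n : ℕ) ω => √(n : ℝ) • (θhat n ω - θ₀)) atTop id
          (fun _ => Pr)
          (multivariateGaussian 0
            (sandwich (M.obsLaw μX F θ₀) (M.workingScore Fstar a) θ₀))) ∧
    -- local efficiency, when the working model is correct and `∂(S⁎_eff f)/∂θ` is dominated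
    ((∀ᵐ x ∂μX, Fstar x = F x) →
      (∃ g : FullData p → ℝ, Integrable g (M.dominating μX F) ∧
        ∀ᵐ d ∂(M.dominating μX F), ∀ θ ∈ N,
          ‖fderiv ℝ (fun ϑ => M.density ϑ d • M.workingScore Fstar a ϑ (obs d)) θ‖ ≤ g d) →
      (fun d => M.workingScore Fstar a θ₀ (obs d)) =ᵐ[M.fullLaw μX F θ₀]
        efficientScore (M.fullLaw μX F θ₀) (M.fullScore θ₀) ∧
      IsUnit (efficientInformation (M.fullLaw μX F θ₀) (M.fullScore θ₀)).det ∧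
      efficiencyBound (M.fullLaw μX F θ₀) (M.fullScore θ₀) =
        (efficientInformation (M.fullLaw μX F θ₀) (M.fullScore θ₀))⁻¹ ∧
      sandwich (M.obsLaw μX F θ₀) (M.workingScore Fstar a) θ₀ =
        efficiencyBound (M.fullLaw μX F θ₀) (M.fullScore θ₀) ∧
      -- the bound is the smallest variance of an influence function, and it is attained
      (∃ φ : Obs p → Param p, IsInfluenceFunction (M.fullLaw μX F θ₀) (M.fullScore θ₀) φ ∧
        (fun d => φ (obs d)) =ᵐ[M.fullLaw μX F θ₀]
          efficientInfluence (M.fullLaw μX F θ₀) (M.fullScore θ₀)) ∧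
      ∀ φ : Obs p → Param p, IsInfluenceFunction (M.fullLaw μX F θ₀) (M.fullScore θ₀) φ →
        (secondMoment (M.fullLaw μX F θ₀) (fun d => φ (obs d)) -
          efficiencyBound (M.fullLaw μX F θ₀) (M.fullScore θ₀)).PosSemidef) := by
  have hI : ∀ θ ∈ N, M.InteriorAt μX Fstar θ := fun θ hθ => by
    filter_upwards [hdom] with d hd using hd θ hθ
  refine ⟨Model.workingScore_asymptotics hac hindep hlaw hN hθ₀ hI hscore ha hsq hC1 hJint hJunif
    hJinv, ?_⟩
  rintro hcorrect ⟨g, hg, hbound⟩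
  -- Only the laws are rewritten; the working score keeps its Bayes version built from `Fstar`, so
  -- kernels equal merely for almost every x suffice.
  have hD : M.dominating μX F = M.dominating μX Fstar := by
    rw [Model.dominating, Model.dominating,
      Measure.compProd_congr (hcorrect.mono fun x hx => hx.symm)]
  have hfull : M.fullLaw μX F θ₀ = M.fullLaw μX Fstar θ₀ := by
    rw [Model.fullLaw, Model.fullLaw, hD]
  have hobs : M.obsLaw μX F θ₀ = M.obsLaw μX Fstar θ₀ := by
    rw [Model.obsLaw, Model.obsLaw, hfull]
  have hJint₀ := hJint θ₀ hθ₀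
  rw [hobs] at hsq hC1 hJinv hJint₀ ⊢
  rw [hD] at hg hbound
  rw [hfull]
  exact Model.workingScore_efficient hN hθ₀ hdom hscore ha hsq hC1 hJint₀ hJinv hg hbound
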